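/- Let $T\subset SU(3)$ be the maximal torus of diagonal matrices and $\mathcal E=SU(3)/T$ the flag manifold, with the left $SU(3)$-action and the invariant measure $d\mathbf z$ of total mass $1$ (the image of the Haar probability measure). Let $\omega_1,\omega_2$ be the fundamental weights (the weight $m\omega_1+n\omega_2$ is the character $\mathrm{diag}(t_1,t_2,t_3)\mapsto t_1^{m+n}t_2^{n}$ of $T$), and order weights by $\tau\le\omega$ iff $\omega-\tau$ is a combination of the simple roots $\alpha_1=2\omega_1-\omega_2$, $\alpha_2=-\omega_1+2\omega_2$ with nonnegative integer coefficients. Let $p,q\ge 0$ be integers and let $\rho$ be a continuous irreducible unitary representation of $SU(3)$ of class $Q(p,q)$, i.e. with highest weight $p\omega_1+q\omega_2$, on a finite-dimensional complex Hilbert space $\mathcal H$. For $A\in\mathcal B(\mathcal H)$ and $g\in SU(3)$ put $A^g=\rho(g)A\rho(g)^{-1}$. A symbol correspondence is an injective linear map $W:\mathcal B(\mathcal H)\to C^\infty_{\mathbb C}(\mathcal E)$, $A\mapsto W_A$, such that for all $A\in\mathcal B(\mathcal H)$: (i) $W_{A^g}(\mathbf z)=W_A(g^{-1}\mathbf z)$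 for all $g\in SU(3)$, $\mathbf z\in\mathcal E$; (ii) $W_{A^\dagger}=\overline{W_A}$; (iii) $\int_{\mathcal E}W_A(\mathbf z)\,d\mathbf z=\frac{1}{\dim\mathcal H}\operatorname{tr}(A)$. Fix a point $\mathbf z_0\in\mathcal E$ whose isotropy subgroup is $T$. An operator $K\in\mathcal B(\mathcal H)$ is an operator kernel if there is a symbol correspondence $W$ with $W_A(g\mathbf z_0)=\operatorname{tr}(AK^g)$ for all $A\in\mathcal B(\mathcal H)$ and $g\in SU(3)$. **Theorem.** The orthogonal projector $\Pi_>$ onto the highest weight space of $\rho$ (weight $p\omega_1+q\omega_2$) is an operator kernel. The lowest weight of $\rho$ is $-q\omega_1-p\omega_2$, and the orthogonal projector $\Pi_<$ onto the lowest weight space is an operator kernel. -/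

import Mathlib

open MeasureTheory
open scoped ContDiff

noncomputable section

/-! ### The group `SU(3)`, its maximal torus, and its Haar measure -/

/-- The group `SU(3)`. -/
abbrev SU3 : Type := Matrix.specialUnitaryGroup (Fin 3) ℂ

instance SU3.instContinuousInv : ContinuousInv SU3 where
  continuous_inv := by
    refine Continuous.subtype_mk (f := fun g : SU3 => star g.1) ?_ _
    exact continuous_star.comp continuous_subtype_val

instance SU3.instIsTopologicalGroup : IsTopologicalGroup SU3 where

instance SU3.instCompactSpace : CompactSpace SU3 := by
  refine isCompact_iff_compactSpace.1 (?_ : IsCompact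
    (Matrix.specialUnitaryGroup (Fin 3) ℂ : Set (Matrix (Fin 3) (Fin 3) ℂ)))
  have hK : IsCompact {M : Matrix (Fin 3) (Fin 3) ℂ |
      ∀ i, (M i) ∈ {r : Fin 3 → ℂ | ∀ j, r j ∈ Metric.closedBall (0 : ℂ) 1}} :=
    isCompact_pi_infinite fun _ => isCompact_pi_infinite fun _ => isCompact_closedBall 0 1
  refine hK.of_isClosed_subset ?_ ?_
  · have h : (Matrix.specialUnitaryGroup (Fin 3) ℂ : Set (Matrix (Fin 3) (Fin 3) ℂ)) =
        {M | M * star M = 1} ∩ {M | M.det = 1} := by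
      ext M
      simp only [SetLike.mem_coe, Matrix.mem_specialUnitaryGroup_iff, Matrix.mem_unitaryGroup_iff,
        Set.mem_inter_iff, Set.mem_ofPred_eq]
    rw [h]
    exact (isClosed_eq (continuous_id.mul continuous_star) continuous_const).inter
      (isClosed_eq (continuous_id.matrix_det) continuous_const)
  · intro M hM i j
    simpa using entry_norm_bound_of_unitary (Matrix.mem_specialUnitaryGroup_iff.1 hM).1 i j

instance SU3.instMeasurableSpace : MeasurableSpace SU3 := borel SU3

instance SU3.instBorelSpace : BorelSpace SU3 := ⟨rfl⟩

/-- The Haar probability measure on `SU(3)`. -/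
def SU3.haar : Measure SU3 := Measure.haarMeasure ⊤

/-- The maximal torus `T ⊆ SU(3)` of diagonal matrices. -/
def SU3.torus : Subgroup SU3 where
  carrier := {g | g.1.IsDiag}
  one_mem' := Matrix.isDiag_one
  mul_mem' := by
    intro a b ha hb
    change (a.1 * b.1).IsDiag
    rw [← ha.diagonal_diag, ← hb.diagonal_diag, Matrix.diagonal_mul_diagonal]
    exact Matrix.isDiag_diagonal _
  inv_mem' := by
    intro a ha
    exact Matrix.IsDiag.conjTranspose ha

/-! ### The flag manifold `𝓔 = SU(3)/T` -/

/-- The flag manifold `𝓔 = SU(3)/T`, with the `SU(3)`-action by left translation. -/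
abbrev FlagManifold : Type := SU3 ⧸ SU3.torus

/-- The normalized `SU(3)`-invariant measure on `𝓔`: the image of the Haar probability measure,
so that the integral over `𝓔` of a function is the Haar integral of its lift to `SU(3)`. -/
def FlagManifold.measure : Measure FlagManifold :=
  SU3.haar.map (QuotientGroup.mk : SU3 → FlagManifold)

/-- The matrix entries of `g ∈ SU(3)`, as a point of the normed space `ℂ^{3×3}`. -/
def SU3.entries (g : SU3) : Fin 3 → Fin 3 → ℂ := fun i j => g.1 i j

/-- Smooth functions on the embedded submanifold `SU(3) ⊆ ℂ^{3×3}`: near every point the function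
is the restriction of a (real-)smooth function on an open subset of the ambient space. -/
def SU3.IsSmooth (f : SU3 → ℂ) : Prop :=
  ∀ g : SU3, ∃ U : Set (Fin 3 → Fin 3 → ℂ), IsOpen U ∧ g.entries ∈ U ∧
    ∃ F : (Fin 3 → Fin 3 → ℂ) → ℂ, ContDiffOn ℝ ∞ F U ∧
      ∀ h : SU3, h.entries ∈ U → f h = F h.entries

/-- Smooth functions on `𝓔 = SU(3)/T`. As `SU(3) → 𝓔` is a surjective submersion, a function
on `𝓔` is smooth iff its lift to `SU(3)` is smooth. -/
def FlagManifold.IsSmooth (f : FlagManifold → ℂ) : Prop :=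
  SU3.IsSmooth fun g => f (g : FlagManifold)

/-! ### Unitary representations, weights, and the classes `Q(p,q)` -/

section Representations

variable {H : Type*} [NormedAddCommGroup H] [InnerProductSpace ℂ H] [CompleteSpace H]

/-- The representation on the vector space `H` underlying a unitary representation. -/
def toRepresentation (ρ : SU3 →* unitary (H →L[ℂ] H)) : Representation ℂ SU3 H :=
  (ContinuousLinearMap.toLinearMapRingHom (R₁ := ℂ) (M₁ := H)).toMonoidHom.comp
    ((unitary (H →L[ℂ] H)).subtype.comp ρ)

/-- A weight `m ω₁ + n ω₂`, written in terms of the fundamental weights `ω₁, ω₂` of `SU(3)`.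
It is the character `diag(t₁,t₂,t₃) ↦ t₁^(m+n) t₂^n` of the torus; equivalently, `m/2` and `n/2`
are the eigenvalues of `T₃ = diag(1/2,-1/2,0)` and `U₃ = diag(0,1/2,-1/2)`. -/
abbrev Weight : Type := ℤ × ℤ

/-- The character of the torus given by a weight. -/
def Weight.char (μ : Weight) (t : SU3) : ℂ := t.1 0 0 ^ (μ.1 + μ.2) * t.1 1 1 ^ μ.2

/-- The simple root `α₁ = 2 ω₁ - ω₂`. -/
def simpleRoot₁ : Weight := (2, -1)

/-- The simple root `α₂ = -ω₁ + 2 ω₂`. -/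
def simpleRoot₂ : Weight := (-1, 2)

/-- The partial order of weights: `τ ≼ μ` iff `μ - τ` is a combination of the simple roots with
nonnegative integer coefficients. -/
def Weight.LE (τ μ : Weight) : Prop :=
  ∃ c₁ c₂ : ℕ, μ - τ = c₁ • simpleRoot₁ + c₂ • simpleRoot₂

/-- The space of vectors of weight `μ` in a unitary representation. -/
def weightSpace (ρ : SU3 →* unitary (H →L[ℂ] H)) (μ : Weight) : Submodule ℂ H where
  carrier := {v | ∀ t ∈ SU3.torus, (ρ t : H →L[ℂ] H) v = μ.char t • v}
  zero_mem' := by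
    intro t _
    simp
  add_mem' := by
    intro a b ha hb t ht
    rw [map_add, ha t ht, hb t ht, smul_add]
  smul_mem' := by
    intro c v hv t ht
    rw [map_smul, hv t ht, smul_comm]

/-- `μ` is a weight of the representation. -/
def IsWeight (ρ : SU3 →* unitary (H →L[ℂ] H)) (μ : Weight) : Prop := weightSpace ρ μ ≠ ⊥

/-- `μ` is the highest weight of the representation. -/
def IsHighestWeight (ρ : SU3 →* unitary (H →L[ℂ] H)) (μ : Weight) : Prop :=
  IsWeight ρ μ ∧ ∀ τ, IsWeight ρ τ → τ.LE μ

/-- `μ` is the lowest weight of the representation. -/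
def IsLowestWeight (ρ : SU3 →* unitary (H →L[ℂ] H)) (μ : Weight) : Prop :=
  IsWeight ρ μ ∧ ∀ τ, IsWeight ρ τ → μ.LE τ

/-- `ρ` is a (continuous) irreducible unitary representation of `SU(3)` of class `Q(p,q)`, that is,
with highest weight `p ω₁ + q ω₂`. -/
structure IsIrrepOfClass (ρ : SU3 →* unitary (H →L[ℂ] H)) (p q : ℕ) : Prop where
  continuous : Continuous ρ
  irreducible : (toRepresentation ρ).IsIrreducible
  highestWeight : IsHighestWeight ρ ((p : ℤ), (q : ℤ))

/-- The action `A ↦ A^g = ρ(g) A ρ(g)⁻¹` of `SU(3)` on operators. -/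
def conjAction (ρ : SU3 →* unitary (H →L[ℂ] H)) (g : SU3) (A : H →L[ℂ] H) : H →L[ℂ] H :=
  (ρ g : H →L[ℂ] H) * A * (ρ g⁻¹ : H →L[ℂ] H)

/-- The trace of an operator (on a finite-dimensional space). -/
def opTrace (A : H →L[ℂ] H) : ℂ := LinearMap.trace ℂ H (A : H →ₗ[ℂ] H)

/-! ### Symbol correspondences and operator kernels -/

/-- Symbol correspondences `W : 𝓑(H) → C^∞(𝓔)`: injective linear maps that are equivariant
(where `f^g(z) = f(g⁻¹ z)`), real, and normalized. -/
structure IsSymbolCorrespondence (ρ : SU3 →* unitary (H →L[ℂ] H))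
    (W : (H →L[ℂ] H) →ₗ[ℂ] (FlagManifold → ℂ)) : Prop where
  smooth : ∀ A, FlagManifold.IsSmooth (W A)
  injective : Function.Injective W
  equivariant : ∀ (g : SU3) (A : H →L[ℂ] H) (z : FlagManifold),
    W (conjAction ρ g A) z = W A (g⁻¹ • z)
  real : ∀ (A : H →L[ℂ] H) (z : FlagManifold),
    W (ContinuousLinearMap.adjoint A) z = (starRingEnd ℂ) (W A z)
  normalized : ∀ A : H →L[ℂ] H,
    ∫ z, W A z ∂FlagManifold.measure = (Module.finrank ℂ H : ℂ)⁻¹ * opTrace A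

/-- `K` is an operator kernel (with respect to the base point `z₀ ∈ 𝓔`): the formula
`W_A(g z₀) = tr(A K^g)` defines a symbol correspondence `W`. -/
def IsOperatorKernel (ρ : SU3 →* unitary (H →L[ℂ] H)) (z₀ : FlagManifold)
    (K : H →L[ℂ] H) : Prop :=
  ∃ W : (H →L[ℂ] H) →ₗ[ℂ] (FlagManifold → ℂ), IsSymbolCorrespondence ρ W ∧
    ∀ (A : H →L[ℂ] H) (g : SU3), W A (g • z₀) = opTrace (A * conjAction ρ g K)

/-- The orthogonal projector onto the space of vectors of weight `μ`. -/
def weightProjector [FiniteDimensional ℂ H] (ρ : SU3 →* unitary (H →L[ℂ] H)) (μ : Weight) :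
    H →L[ℂ] H :=
  (weightSpace ρ μ).starProjection

end Representations

end

noncomputable section

/-! ### Smooth extension of a representation to the space of all matrices -/

section Extension

attribute [local instance] Matrix.normedAddCommGroup Matrix.normedSpace

/-! For a unit vector `u` spanning a weight space, the candidate symbol is `g ↦ ⟪ρ(g)u, A ρ(g)u⟫`.
Torus phases cancel, so it descends to the flag manifold; equivariance and reality are formal, and
normalization is Schur's lemma applied to the average of the conjugates of the projector. The
substance is injectivity, together with one-dimensionality of the weight space.

Both come from complexifying. `exists_contDiff_extension` extends `ρ` to a holomorphic
operator-valued function `P` of all 3×3 matrices, and identities valid on `SU(3)` persist on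
`SU3.hull`, which contains the root subgroups and the complex torus. The Taylor coefficients of `P`
along a root subgroup shift weights by multiples of the root. Hence upper unipotents fix a highest
weight vector `v`, and lower unipotents fix the functional `⟪v, ·⟫`. Since the big cell
(lower)(torus)(upper) is dense, the vectors `P L v`, with `L` lower unipotent, span
(`IsExtension.eq_zero_of_inner_lowerUnipotent`).

For injectivity (`IsExtension.eq_zero_of_inner_coherent`), write the symbol as `⟪v, ρ(g)⁻¹ A ρ(g)
v⟫`, which is holomorphic in `g`, and evaluate it at `gL`. The factor `L⁻¹` is absorbed by `⟪v, ·⟫`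
while the vectors `P L v` span, so the diagonal matrix elements determine all others. The longest
Weyl element carries the highest weight line to the lowest one, and both lines have the same orbit
under `SU(3)`. -/

instance SU3.instIsHaarMeasureHaar : SU3.haar.IsHaarMeasure :=
  inferInstanceAs (Measure.haarMeasure ⊤).IsHaarMeasure

instance SU3.instIsProbabilityMeasureHaar : IsProbabilityMeasure SU3.haar :=
  ⟨Measure.haarMeasure_self (K₀ := ⊤)⟩

instance SU3.instMetrizableSpace : TopologicalSpace.MetrizableSpace SU3 :=
  haveI : TopologicalSpace.MetrizableSpace (Matrix (Fin 3) (Fin 3) ℂ) :=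
    inferInstanceAs (TopologicalSpace.MetrizableSpace (Fin 3 → Fin 3 → ℂ))
  Topology.IsEmbedding.subtypeVal.metrizableSpace

lemma SU3.integrable_of_continuous {E : Type*} [NormedAddCommGroup E] {f : SU3 → E}
    (hf : Continuous f) : Integrable f SU3.haar :=
  hf.integrable_of_hasCompactSupport (HasCompactSupport.of_compactSpace f)

lemma SU3.star_mul_self (g : SU3) : star g.1 * g.1 = 1 :=
  Matrix.mem_unitaryGroup_iff'.1 (Matrix.mem_specialUnitaryGroup_iff.1 g.2).1

lemma SU3.det_eq_one (g : SU3) : g.1.det = 1 := (Matrix.mem_specialUnitaryGroup_iff.1 g.2).2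

lemma SU3.coe_inv (g : SU3) : (g⁻¹ : SU3).1 = star g.1 := rfl

lemma SU3.adjugate_eq_star (g : SU3) : g.1.adjugate = star g.1 := by
  have h := congrArg (star g.1 * ·) (Matrix.mul_adjugate g.1)
  simpa [← mul_assoc, g.star_mul_self, g.det_eq_one] using h

/-- The integral of a power of a finite sum `∑ aᵢ(h) bᵢ(M)` against a continuous function of `h`
is as smooth in `M` as the `bᵢ`. -/
lemma SU3.contDiff_integral_pow_smul {E V ι : Type*} [NormedAddCommGroup E] [NormedSpace ℂ E]
    [NormedAddCommGroup V] [NormedSpace ℂ V] [Fintype ι] {a : ι → SU3 → ℂ} {b : ι → V → ℂ}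
    (ha : ∀ i, Continuous (a i)) (hb : ∀ i, ContDiff ℂ ∞ (b i)) (N : ℕ) :
    ∀ {R : SU3 → E}, Continuous R →
      ContDiff ℂ ∞ fun M => ∫ h, (∑ i, a i h * b i M) ^ N • R h ∂SU3.haar := by
  induction N with
  | zero =>
    intro R _
    simpa using contDiff_const
  | succ N ih =>
    intro R hR
    -- Peel off one factor of the power: its `h`-part joins `R` and its `M`-part leaves the
    -- integral, so nothing is ever differentiated under the integral sign.
    have key : (fun M => ∫ h, (∑ i, a i h * b i M) ^ (N + 1) • R h ∂SU3.haar) =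
        fun M => ∑ i, b i M • ∫ h, (∑ i, a i h * b i M) ^ N • (a i h • R h) ∂SU3.haar := by
      funext M
      simp_rw [← integral_smul]
      rw [← integral_finsetSum _ fun i _ => SU3.integrable_of_continuous (by fun_prop)]
      congr 1
      funext h
      rw [pow_succ, mul_smul, Finset.sum_smul, Finset.smul_sum]
      refine Finset.sum_congr rfl fun i _ => ?_
      simp only [smul_smul]
      congr 1
      ring
    rw [key]
    exact ContDiff.sum fun i _ => (hb i).smul (ih ((ha i).smul hR))

/-- For `g = h k` in `SU(3)` this is the class function `6 + 2 Re (tr k)`, which peaks at `1`;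
it is polynomial in the second argument. -/
def SU3.peak (h : SU3) (M : Matrix (Fin 3) (Fin 3) ℂ) : ℂ :=
  6 + (star h.1 * M).trace + (h.1 * M.adjugate).trace

/-- Separates the two variables, as `SU3.contDiff_integral_pow_smul` requires. The adjugate stands
for the inverse on `SU(3)`, which keeps the expression free of complex conjugates of `M`. -/
lemma SU3.peak_eq_sum (h : SU3) (M : Matrix (Fin 3) (Fin 3) ℂ) :
    h.peak M = ∑ i : Unit ⊕ (Fin 3 × Fin 3) ⊕ (Fin 3 × Fin 3),
      (Sum.elim (fun _ _ => 6) (Sum.elim (fun x h => star (h.1 x.2 x.1)) fun x h => h.1 x.1 x.2) :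
        Unit ⊕ (Fin 3 × Fin 3) ⊕ (Fin 3 × Fin 3) → SU3 → ℂ) i h *
      (Sum.elim (fun _ _ => 1) (Sum.elim (fun x M => M x.2 x.1) fun x M => M.adjugate x.2 x.1) :
        Unit ⊕ (Fin 3 × Fin 3) ⊕ (Fin 3 × Fin 3) → Matrix (Fin 3) (Fin 3) ℂ → ℂ) i M := by
  simp only [Fintype.sum_sum_type, Sum.elim_inl, Sum.elim_inr, Fintype.sum_prod_type, SU3.peak,
    Matrix.trace, Matrix.diag, Matrix.mul_apply, Matrix.star_apply]
  simp [add_assoc]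

lemma contDiff_matrix_entry (i j : Fin 3) :
    ContDiff ℂ ∞ fun M : Matrix (Fin 3) (Fin 3) ℂ => M i j :=
  contDiff_apply_apply ℂ ℂ i j

lemma contDiff_matrix_adjugate (i j : Fin 3) :
    ContDiff ℂ ∞ fun M : Matrix (Fin 3) (Fin 3) ℂ => M.adjugate i j := by
  have h := contDiff_matrix_entry
  fin_cases i <;> fin_cases j <;>
    simp only [Matrix.adjugate_fin_three, Matrix.of_apply, Matrix.cons_val', Matrix.cons_val,
      Fin.mk_one, Fin.zero_eta, Fin.reduceFinMk] <;>
    fun_prop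

lemma SU3.contDiff_integral_peak_pow_smul {E : Type*} [NormedAddCommGroup E] [NormedSpace ℂ E]
    (N : ℕ) {R : SU3 → E} (hR : Continuous R) :
    ContDiff ℂ ∞ fun M => ∫ h : SU3, h.peak M ^ N • R h ∂SU3.haar := by
  simp_rw [SU3.peak_eq_sum]
  refine SU3.contDiff_integral_pow_smul ?_ ?_ N hR
  · have h : ∀ i j, Continuous fun h : SU3 => h.1 i j := fun i j =>
      (continuous_apply_apply i j).comp continuous_subtype_val
    rintro (x | x | x)
    · exact continuous_const
    · exact continuous_star.comp (h _ _)
    · exact h _ _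
  · rintro (x | x | x)
    · exact contDiff_const
    · exact contDiff_matrix_entry _ _
    · exact contDiff_matrix_adjugate _ _

lemma SU3.peak_mul (g k : SU3) : (g * k).peak g.1 = 6 + 2 * k.1.trace.re := by
  have h1 : star (g * k).1 * g.1 = star k.1 := by
    change star (g.1 * k.1) * g.1 = _
    rw [star_mul, mul_assoc, g.star_mul_self, mul_one]
  have h2 : ((g * k).1 * star g.1).trace = k.1.trace := by
    change (g.1 * k.1 * star g.1).trace = _
    rw [Matrix.trace_mul_comm, ← mul_assoc, g.star_mul_self, one_mul]
  rw [SU3.peak, SU3.adjugate_eq_star, h1, h2, Matrix.star_eq_conjTranspose,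
    Matrix.trace_conjTranspose, add_assoc, ← Complex.ofReal_ofNat 2, ← Complex.ofReal_mul,
    ← Complex.add_conj, add_comm (star _)]
  rfl

open scoped ComplexOrder in
-- The quantity is `tr ((k+1)* (k+1))`, which explains the constant 6. The next bound uses `tr
-- ((k-1)* (k-1))` in the same way.
lemma SU3.trace_re_nonneg (k : SU3) : 0 ≤ 6 + 2 * k.1.trace.re := by
  have h := (Matrix.posSemidef_conjTranspose_mul_self (k.1 + 1)).trace_nonneg
  have h2 : ((k.1 + 1).conjTranspose * (k.1 + 1)).trace = 6 + star k.1.trace + k.1.trace := by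
    have := k.star_mul_self
    rw [Matrix.star_eq_conjTranspose] at this
    simp [add_mul, mul_add, this, Matrix.trace_conjTranspose]
    ring
  rw [h2, Complex.le_def] at h
  simp at h
  linarith [h]

open scoped ComplexOrder in
lemma SU3.trace_re_lt {k : SU3} (hk : k ≠ 1) : 6 + 2 * k.1.trace.re < 12 := by
  have h := (Matrix.posSemidef_conjTranspose_mul_self (k.1 - 1)).trace_nonneg
  have h2 : ((k.1 - 1).conjTranspose * (k.1 - 1)).trace = 6 - star k.1.trace - k.1.trace := by
    have := k.star_mul_self
    rw [Matrix.star_eq_conjTranspose] at this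
    simp [sub_mul, mul_sub, this, Matrix.trace_conjTranspose]
    ring
  have h3 : ((k.1 - 1).conjTranspose * (k.1 - 1)).trace ≠ 0 := by
    rw [Ne, Matrix.trace_conjTranspose_mul_self_eq_zero_iff, sub_eq_zero]
    exact fun h => hk (Subtype.ext h)
  have h4 := lt_of_le_of_ne h h3.symm
  rw [h2, Complex.lt_def] at h4
  simp at h4
  linarith [h4]

variable {H : Type*} [NormedAddCommGroup H] [InnerProductSpace ℂ H] [CompleteSpace H]

/-- A continuous unitary representation extends to a smooth (over `ℂ`) operator-valued function
on the space of all matrices. -/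
lemma exists_contDiff_extension [FiniteDimensional ℂ H] {ρ : SU3 →* unitary (H →L[ℂ] H)}
    (hρ : Continuous ρ) :
    ∃ P : Matrix (Fin 3) (Fin 3) ℂ → (H →L[ℂ] H), ContDiff ℂ ∞ P ∧
      ∀ g : SU3, P g.1 = (ρ g : H →L[ℂ] H) := by
  have hR : Continuous fun g : SU3 => (ρ g : H →L[ℂ] H) := continuous_subtype_val.comp hρ
  let Φ : ℕ → Matrix (Fin 3) (Fin 3) ℂ → (H →L[ℂ] H) := fun N M =>
    ∫ h : SU3, h.peak M ^ N • (ρ h : H →L[ℂ] H) ∂SU3.haar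
  -- Substitute `h = gk` in the Haar integral: the weight then depends on `k` only, and `ρ g`
  -- factors out. Once `Φ N 1` is invertible, `Φ N M * (Φ N 1)⁻¹` is the desired extension.
  have hΦ : ∀ N (g : SU3), Φ N g.1 = (ρ g : H →L[ℂ] H) * Φ N 1 := by
    intro N g
    have h1 : ∀ g : SU3, Φ N g.1 = ∫ k : SU3, ((6 + 2 * k.1.trace.re : ℝ) : ℂ) ^ N •
        ((ρ g : H →L[ℂ] H) * (ρ k : H →L[ℂ] H)) ∂SU3.haar := by
      intro g
      change ∫ h : SU3, h.peak g.1 ^ N • (ρ h : H →L[ℂ] H) ∂SU3.haar = _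
      rw [← integral_mul_left_eq_self _ g]
      congr 1
      funext k
      rw [SU3.peak_mul, map_mul]
      push_cast
      rfl
    have hc : Continuous fun k : SU3 => ((6 + 2 * k.1.trace.re : ℝ) : ℂ) ^ N := by
      have : Continuous fun k : SU3 => k.1.trace := continuous_subtype_val.matrix_trace
      fun_prop
    have h2 := h1 1
    rw [h1 g]
    change Φ N 1 = _ at h2
    rw [h2]
    simp only [map_one, OneMemClass.coe_one, one_mul]
    have := ((ContinuousLinearMap.mul ℂ (H →L[ℂ] H)) (ρ g : H →L[ℂ] H)).integral_comp_comm
      (SU3.integrable_of_continuous (hc.smul hR))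
    simpa using this
  -- The normalized weights concentrate at the identity, so the normalized `Φ N 1` tends to `ρ 1 =
  -- 1`, and invertibility is an open condition.
  have hlim : ∃ N, IsUnit (Φ N 1) := by
    have hc : Continuous fun k : SU3 => 6 + 2 * k.1.trace.re := by
      have : Continuous fun k : SU3 => k.1.trace := continuous_subtype_val.matrix_trace
      fun_prop
    have h := tendsto_setIntegral_pow_smul_of_unique_maximum_of_isCompact_of_continuousOn
      (μ := SU3.haar) (s := Set.univ) (x₀ := (1 : SU3))
      (c := fun k : SU3 => 6 + 2 * k.1.trace.re) (g := fun k : SU3 => (ρ k : H →L[ℂ] H))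
      isCompact_univ hc.continuousOn (fun y _ hy => ?_) (fun y _ => y.trace_re_nonneg)
      (by norm_num) (by simp) hR.continuousOn
    · have hopen : {A : H →L[ℂ] H | IsUnit A} ∈ nhds ((ρ 1 : unitary (H →L[ℂ] H)) : H →L[ℂ] H) := by
        refine Units.isOpen.mem_nhds ?_
        simp
      obtain ⟨N, hN⟩ := (h.eventually hopen).exists
      refine ⟨N, ?_⟩
      have h1 : Φ N 1 = ∫ k : SU3, (6 + 2 * k.1.trace.re) ^ N • (ρ k : H →L[ℂ] H) ∂SU3.haar := by
        refine integral_congr_ae (Filter.Eventually.of_forall fun k => ?_)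
        have := SU3.peak_mul 1 k
        rw [one_mul] at this
        change k.peak 1 = _ at this
        simp only [this]
        rw [← Complex.coe_smul]
        push_cast
        rfl
      rw [setIntegral_univ, setIntegral_univ, ← h1] at hN
      -- Positivity of the integral need not be shown: if the normalizing factor vanished, `0` would
      -- be a unit and the operator ring trivial.
      rcases eq_or_ne ((∫ k : SU3, (6 + 2 * k.1.trace.re) ^ N ∂SU3.haar)⁻¹) 0 with h0 | h0
      · rw [h0, zero_smul] at hN
        have : Subsingleton (H →L[ℂ] H) := isUnit_zero_iff.1 hN |> subsingleton_of_zero_eq_one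
        exact isUnit_of_subsingleton _
      · rw [← Complex.coe_smul] at hN
        have h0' : (((∫ k : SU3, (6 + 2 * k.1.trace.re) ^ N ∂SU3.haar)⁻¹ : ℝ) : ℂ) ≠ 0 := by
          exact_mod_cast h0
        have := (isUnit_smul_iff (Units.mk0 _ h0') (Φ N 1)).1 hN
        exact this
    · have := SU3.trace_re_lt hy
      have h3 : (1 : SU3).1.trace = 3 := by simp
      simp only [h3]
      norm_num
      linarith
  obtain ⟨N, u, hu⟩ := hlim
  refine ⟨fun M => Φ N M * (↑u⁻¹ : H →L[ℂ] H),
    (SU3.contDiff_integral_peak_pow_smul N hR).mul contDiff_const, fun g => ?_⟩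
  simp only
  rw [hΦ N g, ← hu, mul_assoc, Units.mul_inv, mul_one]

end Extension

/-! ### The holomorphic hull of `SU(3)` -/

section Hull

attribute [local instance] Matrix.normedAddCommGroup Matrix.normedSpace

/-- An entire function vanishing on the real line vanishes. -/
lemma Differentiable.eq_zero_of_ofReal {E : Type*} [NormedAddCommGroup E] [NormedSpace ℂ E]
    [CompleteSpace E] {f : ℂ → E} (hf : Differentiable ℂ f) (h : ∀ x : ℝ, f x = 0) (z : ℂ) :
    f z = 0 := by
  have hfa : AnalyticOnNhd ℂ f Set.univ := fun z _ => hf.analyticAt z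
  refine hfa.eqOn_zero_of_preconnected_of_frequently_eq_zero isPreconnected_univ
    (Set.mem_univ 0) ?_ (Set.mem_univ z)
  have ht : Filter.Tendsto (fun x : ℝ => (x : ℂ)) (nhdsWithin 0 {0}ᶜ) (nhdsWithin 0 {0}ᶜ) := by
    refine tendsto_nhdsWithin_iff.2 ⟨?_, ?_⟩
    · have := Complex.continuous_ofReal.tendsto 0
      rw [Complex.ofReal_zero] at this
      exact this.mono_left nhdsWithin_le_nhds
    · filter_upwards [self_mem_nhdsWithin] with x hx
      simpa using hx
  exact ht.frequently (Filter.Eventually.of_forall h).frequently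

lemma differentiable_matrix {m n : Type*} [Fintype m] [Fintype n] {V : Type*}
    [NormedAddCommGroup V] [NormedSpace ℂ V] {M : V → Matrix m n ℂ}
    (h : ∀ i j, Differentiable ℂ fun s => M s i j) : Differentiable ℂ M :=
  differentiable_pi.2 fun i => differentiable_pi.2 fun j => h i j

lemma Differentiable.matrix_entry {m n : Type*} [Fintype m] [Fintype n] {V : Type*}
    [NormedAddCommGroup V] [NormedSpace ℂ V] {M : V → Matrix m n ℂ}
    (h : Differentiable ℂ M) (i : m) (j : n) : Differentiable ℂ fun s => M s i j :=
  differentiable_pi.1 (differentiable_pi.1 h i) j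

lemma Differentiable.matrix_mul {l m n : Type*} [Fintype l] [Fintype m] [Fintype n] {V : Type*}
    [NormedAddCommGroup V] [NormedSpace ℂ V] {M : V → Matrix l m ℂ} {N : V → Matrix m n ℂ}
    (hM : Differentiable ℂ M) (hN : Differentiable ℂ N) : Differentiable ℂ fun s => M s * N s := by
  refine differentiable_matrix fun i j => ?_
  simp only [Matrix.mul_apply]
  exact Differentiable.fun_sum fun k _ => (hM.matrix_entry i k).mul (hN.matrix_entry k j)

lemma Differentiable.matrix_transpose {m n : Type*} [Fintype m] [Fintype n] {V : Type*}
    [NormedAddCommGroup V] [NormedSpace ℂ V] {M : V → Matrix m n ℂ}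
    (hM : Differentiable ℂ M) : Differentiable ℂ fun s => (M s).transpose :=
  differentiable_matrix fun i j => hM.matrix_entry j i

/-- The matrices at which every entire function vanishing on `SU(3)` vanishes. (This is
`SL(3,ℂ)`, but we only need some of its elements.) -/
def SU3.hull : Submonoid (Matrix (Fin 3) (Fin 3) ℂ) where
  carrier := {M | ∀ f : Matrix (Fin 3) (Fin 3) ℂ → ℂ, Differentiable ℂ f →
    (∀ g : SU3, f g.1 = 0) → f M = 0}
  one_mem' := fun _ _ h => h 1
  mul_mem' := by
    intro A B hA hB f hf h
    -- Vary one factor at a time: the left one over `SU(3)`, with the right one handled by its own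
    -- membership in the hull.
    refine hA (fun M => f (M * B))
      (hf.comp (differentiable_id.matrix_mul (differentiable_const B))) fun g => ?_
    exact hB (fun M => f (g.1 * M))
      (hf.comp ((differentiable_const g.1).matrix_mul differentiable_id)) fun k => h (g * k)

lemma SU3.coe_mem_hull (g : SU3) : g.1 ∈ SU3.hull := fun _ _ h => h g

lemma SU3.det_of_mem_hull {M : Matrix (Fin 3) (Fin 3) ℂ} (hM : M ∈ SU3.hull) : M.det = 1 := by
  refine sub_eq_zero.1 (hM (fun M => M.det - 1) ?_ fun g => by simp [g.det_eq_one])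
  have h : ∀ i j, Differentiable ℂ fun M : Matrix (Fin 3) (Fin 3) ℂ => M i j :=
    fun i j => differentiable_id.matrix_entry i j
  simp only [Matrix.det_fin_three]
  fun_prop

/-- Continuous functionals reduce the vector-valued identity principle to the scalar one defining
the hull. -/
lemma SU3.eq_of_mem_hull {F : Type*} [NormedAddCommGroup F] [NormedSpace ℂ F]
    {f₁ f₂ : Matrix (Fin 3) (Fin 3) ℂ → F} (h₁ : Differentiable ℂ f₁) (h₂ : Differentiable ℂ f₂)
    (h : ∀ g : SU3, f₁ g.1 = f₂ g.1) {M : Matrix (Fin 3) (Fin 3) ℂ} (hM : M ∈ SU3.hull) :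
    f₁ M = f₂ M := by
  rw [← sub_eq_zero]
  refine (SeparatingDual.eq_zero_iff_forall_dual_eq_zero (R := ℂ) _).2 fun L => ?_
  exact hM (fun M => L (f₁ M - f₂ M)) (by fun_prop) fun g => by simp [h g]

lemma SU3.transpose_mem_hull {M : Matrix (Fin 3) (Fin 3) ℂ} (hM : M ∈ SU3.hull) :
    M.transpose ∈ SU3.hull := by
  intro f hf h
  refine hM (fun M => f M.transpose) (hf.comp differentiable_id.matrix_transpose) fun g => ?_
  refine h ⟨g.1.transpose, Matrix.mem_specialUnitaryGroup_iff.2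
    ⟨Matrix.mem_unitaryGroup_iff.2 ?_, by rw [Matrix.det_transpose, g.det_eq_one]⟩⟩
  have := congrArg Matrix.transpose g.star_mul_self
  rw [Matrix.transpose_mul, Matrix.transpose_one] at this
  exact this

/-- The matrix with the given upper left block. -/
def Matrix.upperBlock (a b c d : ℂ) : Matrix (Fin 3) (Fin 3) ℂ := !![a, b, 0; c, d, 0; 0, 0, 1]

lemma differentiable_upperBlock {V : Type*} [NormedAddCommGroup V] [NormedSpace ℂ V]
    {a b c d : V → ℂ} (ha : Differentiable ℂ a)
    (hb : Differentiable ℂ b) (hc : Differentiable ℂ c) (hd : Differentiable ℂ d) :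
    Differentiable ℂ fun s => Matrix.upperBlock (a s) (b s) (c s) (d s) := by
  refine differentiable_matrix fun i j => ?_
  fin_cases i <;> fin_cases j <;> simp [Matrix.upperBlock] <;> assumption

/-- The elements of `SU(2)`, parametrized by three angles (which we allow to be complex). -/
def Matrix.angleBlock (θ φ ψ : ℂ) : Matrix (Fin 3) (Fin 3) ℂ :=
  Matrix.upperBlock (Complex.cos θ * Complex.exp (φ * Complex.I))
    (-(Complex.sin θ * Complex.exp (ψ * Complex.I)))
    (Complex.sin θ * Complex.exp (-(ψ * Complex.I)))
    (Complex.cos θ * Complex.exp (-(φ * Complex.I)))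

lemma differentiable_angleBlock {θ φ ψ : ℂ → ℂ} (hθ : Differentiable ℂ θ)
    (hφ : Differentiable ℂ φ) (hψ : Differentiable ℂ ψ) :
    Differentiable ℂ fun s => Matrix.angleBlock (θ s) (φ s) (ψ s) := by
  have hE : Differentiable ℂ Complex.exp := Complex.differentiable_exp
  have hC : Differentiable ℂ Complex.cos := Complex.differentiable_cos
  have hS : Differentiable ℂ Complex.sin := Complex.differentiable_sin
  exact differentiable_upperBlock (by fun_prop) (by fun_prop) (by fun_prop) (by fun_prop)

lemma SU3.angleBlock_mem_hull (θ φ ψ : ℂ) : Matrix.angleBlock θ φ ψ ∈ SU3.hull := by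
  intro f hf h
  -- The angles are made real one after another; for three real angles the matrix lies in `SU(3)`.
  refine Differentiable.eq_zero_of_ofReal (f := fun θ => f (Matrix.angleBlock θ φ ψ))
    (hf.comp (differentiable_angleBlock (by fun_prop) (by fun_prop) (by fun_prop)))
    (fun θ => ?_) θ
  refine Differentiable.eq_zero_of_ofReal (f := fun φ => f (Matrix.angleBlock θ φ ψ))
    (hf.comp (differentiable_angleBlock (by fun_prop) (by fun_prop) (by fun_prop)))
    (fun φ => ?_) φ
  refine Differentiable.eq_zero_of_ofReal (f := fun ψ => f (Matrix.angleBlock θ φ ψ))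
    (hf.comp (differentiable_angleBlock (by fun_prop) (by fun_prop) (by fun_prop)))
    (fun ψ => ?_) ψ
  have hφ : Complex.exp (φ * Complex.I) * Complex.exp (-(φ * Complex.I)) = 1 := by
    rw [← Complex.exp_add]; simp
  have hψ : Complex.exp (ψ * Complex.I) * Complex.exp (-(ψ * Complex.I)) = 1 := by
    rw [← Complex.exp_add]; simp
  have hθ := Complex.sin_sq_add_cos_sq θ
  refine h ⟨_, Matrix.mem_specialUnitaryGroup_iff.2 ⟨Matrix.mem_unitaryGroup_iff.2 ?_, ?_⟩⟩
  · have c1 : (starRingEnd ℂ) (Complex.exp (φ * Complex.I)) = Complex.exp (-(φ * Complex.I)) := by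
      rw [← Complex.exp_conj]; simp
    have c2 : (starRingEnd ℂ) (Complex.exp (ψ * Complex.I)) = Complex.exp (-(ψ * Complex.I)) := by
      rw [← Complex.exp_conj]; simp
    have c3 : (starRingEnd ℂ) (Complex.exp (-(φ * Complex.I))) = Complex.exp (φ * Complex.I) := by
      rw [← Complex.exp_conj]; simp
    have c4 : (starRingEnd ℂ) (Complex.exp (-(ψ * Complex.I))) = Complex.exp (ψ * Complex.I) := by
      rw [← Complex.exp_conj]; simp
    have c5 : (starRingEnd ℂ) (Complex.cos θ) = Complex.cos θ := by
      rw [← Complex.cos_conj, Complex.conj_ofReal]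
    have c6 : (starRingEnd ℂ) (Complex.sin θ) = Complex.sin θ := by
      rw [← Complex.sin_conj, Complex.conj_ofReal]
    ext i j
    fin_cases i <;> fin_cases j <;>
      simp [Matrix.mul_apply, Fin.sum_univ_three,
        Matrix.star_apply, c1, c2, c3, c4, c5, c6]
    · linear_combination hθ + Complex.cos θ ^ 2 * hφ + Complex.sin θ ^ 2 * hψ
    · ring
    · ring
    · linear_combination hθ + Complex.cos θ ^ 2 * hφ + Complex.sin θ ^ 2 * hψ
  · simp [Matrix.det_fin_three]
    linear_combination hθ + Complex.cos θ ^ 2 * hφ + Complex.sin θ ^ 2 * hψ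

/-- Solve for complex angles: `cos² θ = ad` forces `sin² θ = -bc`. As no entry vanishes, neither
does the cosine or the sine, and `φ`, `ψ` are then found as logarithms of the quotients. -/
lemma SU3.upperBlock_mem_hull_of_ne_zero {a b c d : ℂ} (ha : a ≠ 0) (hb : b ≠ 0) (hc : c ≠ 0)
    (hd : d ≠ 0) (h : a * d - b * c = 1) : Matrix.upperBlock a b c d ∈ SU3.hull := by
  obtain ⟨κ, hκ⟩ := IsAlgClosed.exists_pow_nat_eq (a * d) zero_lt_two
  obtain ⟨θ, rfl⟩ := Complex.cos_surjective κ
  have hσ : Complex.sin θ ^ 2 = -(b * c) := by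
    linear_combination Complex.sin_sq_add_cos_sq θ - h - hκ
  have hκ0 : Complex.cos θ ≠ 0 := fun h0 => by
    rw [h0] at hκ; exact mul_ne_zero ha hd (by simpa using hκ)
  have hσ0 : Complex.sin θ ≠ 0 := fun h0 => by
    rw [h0] at hσ; exact mul_ne_zero hb hc (by simpa using hσ)
  have hexp : ∀ w : ℂ, w ≠ 0 → ∃ φ : ℂ, Complex.exp (φ * Complex.I) = w := fun w hw =>
    ⟨-(Complex.log w * Complex.I), by
      rw [neg_mul, mul_assoc, Complex.I_mul_I]; simp [Complex.exp_log hw]⟩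
  obtain ⟨φ, hφ⟩ := hexp (a / Complex.cos θ) (div_ne_zero ha hκ0)
  obtain ⟨ψ, hψ⟩ := hexp (-b / Complex.sin θ) (div_ne_zero (neg_ne_zero.2 hb) hσ0)
  convert SU3.angleBlock_mem_hull θ φ ψ using 1
  rw [Matrix.angleBlock, Complex.exp_neg, Complex.exp_neg, hφ, hψ]
  congr 1
  · field_simp
  · field_simp
  · field_simp
    linear_combination hσ
  · field_simp
    linear_combination -hκ

lemma Matrix.upperBlock_mul (a b c d a' b' c' d' : ℂ) :
    Matrix.upperBlock a b c d * Matrix.upperBlock a' b' c' d' =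
      Matrix.upperBlock (a * a' + b * c') (a * b' + b * d') (c * a' + d * c')
        (c * b' + d * d') := by
  ext i j
  fin_cases i <;> fin_cases j <;>
    simp [Matrix.upperBlock, Matrix.mul_apply, Fin.sum_univ_three]

/-- A unipotent block has a zero entry, so it is written as a product of two blocks without zeros.
The two excluded values of `s` are reached as `(s - 2) + 2`. -/
lemma SU3.upperBlock_unipotent_mem_hull (s : ℂ) : Matrix.upperBlock 1 s 0 1 ∈ SU3.hull := by
  have key : ∀ s : ℂ, s + 1 ≠ 0 → s + 2 ≠ 0 → Matrix.upperBlock 1 s 0 1 ∈ SU3.hull := by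
    intro s h1 h2
    have h := SU3.hull.mul_mem
      (SU3.upperBlock_mem_hull_of_ne_zero (a := 2) (b := -1) (c := -1) (d := 1)
        (by norm_num) (by norm_num) (by norm_num) (by norm_num) (by norm_num))
      (SU3.upperBlock_mem_hull_of_ne_zero (a := 1) (b := s + 1) (c := 1) (d := s + 2)
        (by norm_num) h1 (by norm_num) h2 (by ring))
    rw [Matrix.upperBlock_mul] at h
    convert h using 2 <;> ring
  by_cases hs : s + 1 ≠ 0 ∧ s + 2 ≠ 0
  · exact key s hs.1 hs.2
  · have hs' : s = -1 ∨ s = -2 := by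
      rcases not_and_or.1 hs with h | h
      · exact Or.inl (eq_neg_of_add_eq_zero_left (not_not.1 h))
      · exact Or.inr (eq_neg_of_add_eq_zero_left (not_not.1 h))
    have h := SU3.hull.mul_mem (key (s - 2) (by rcases hs' with rfl | rfl <;> norm_num)
      (by rcases hs' with rfl | rfl <;> norm_num)) (key 2 (by norm_num) (by norm_num))
    rw [Matrix.upperBlock_mul] at h
    convert h using 2 <;> ring

/-- A cyclic permutation matrix. -/
def SU3.cycle : SU3 := ⟨!![0, 1, 0; 0, 0, 1; 1, 0, 0], by
  refine Matrix.mem_specialUnitaryGroup_iff.2 ⟨Matrix.mem_unitaryGroup_iff.2 ?_, ?_⟩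
  · ext i j
    fin_cases i <;> fin_cases j <;> simp [Matrix.mul_apply, Fin.sum_univ_three, Matrix.star_apply]
  · simp [Matrix.det_fin_three]⟩

/-- The root subgroups: `1 + s E_ij`. -/
lemma SU3.transvection_mem_hull {i j : Fin 3} (hij : i ≠ j) (s : ℂ) :
    Matrix.transvection i j s ∈ SU3.hull := by
  have h01 : Matrix.transvection 0 1 s ∈ SU3.hull := by
    convert SU3.upperBlock_unipotent_mem_hull s using 1
    ext i j
    fin_cases i <;> fin_cases j <;> simp [Matrix.upperBlock, Matrix.transvection, Matrix.single]
  -- Conjugation by the cyclic permutation moves the index pair `01` to `20` and then to `12`;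
  -- transposition gives the other three pairs.
  have h20 : Matrix.transvection 2 0 s ∈ SU3.hull := by
    convert SU3.hull.mul_mem (SU3.hull.mul_mem (SU3.coe_mem_hull SU3.cycle) h01)
      (SU3.coe_mem_hull SU3.cycle⁻¹) using 1
    rw [SU3.coe_inv]
    ext k l
    fin_cases k <;> fin_cases l <;>
      simp [SU3.cycle, Matrix.mul_apply, Fin.sum_univ_three, Matrix.star_apply,
        Matrix.transvection, Matrix.single, Matrix.vecMul, dotProduct]
  have h12 : Matrix.transvection 1 2 s ∈ SU3.hull := by
    convert SU3.hull.mul_mem (SU3.hull.mul_mem (SU3.coe_mem_hull SU3.cycle) h20)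
      (SU3.coe_mem_hull SU3.cycle⁻¹) using 1
    rw [SU3.coe_inv]
    ext k l
    fin_cases k <;> fin_cases l <;>
      simp [SU3.cycle, Matrix.mul_apply, Fin.sum_univ_three, Matrix.star_apply,
        Matrix.transvection, Matrix.single, Matrix.vecMul, dotProduct]
  have htr : ∀ i j : Fin 3, Matrix.transvection i j s ∈ SU3.hull →
      Matrix.transvection j i s ∈ SU3.hull := by
    intro i j h
    convert SU3.transpose_mem_hull h using 1
    simp [Matrix.transvection]
  fin_cases i <;> fin_cases j <;> first | exact absurd rfl hij | assumption | exact htr _ _ ‹_›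

end Hull

/-! ### Weights and the action of root subgroups -/

section Torus

lemma SU3.torus_apply_of_ne {t : SU3} (ht : t ∈ SU3.torus) {i j : Fin 3} (hij : i ≠ j) :
    t.1 i j = 0 := ht hij

lemma SU3.torus_star_mul {t : SU3} (ht : t ∈ SU3.torus) (i : Fin 3) :
    (starRingEnd ℂ) (t.1 i i) * t.1 i i = 1 := by
  have h := congrFun (congrFun t.star_mul_self i) i
  rw [Matrix.mul_apply, Finset.sum_eq_single i
    (fun k _ hk => by rw [SU3.torus_apply_of_ne ht hk, mul_zero]) (by simp)] at h
  simpa [Matrix.star_apply] using h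

lemma SU3.torus_apply_ne_zero {t : SU3} (ht : t ∈ SU3.torus) (i : Fin 3) : t.1 i i ≠ 0 :=
  right_ne_zero_of_mul_eq_one (SU3.torus_star_mul ht i)

lemma SU3.torus_prod {t : SU3} (ht : t ∈ SU3.torus) : t.1 0 0 * t.1 1 1 * t.1 2 2 = 1 := by
  have h := t.det_eq_one
  rw [Matrix.det_fin_three, SU3.torus_apply_of_ne ht (show (0 : Fin 3) ≠ 1 by decide),
    SU3.torus_apply_of_ne ht (show (0 : Fin 3) ≠ 2 by decide),
    SU3.torus_apply_of_ne ht (show (1 : Fin 3) ≠ 2 by decide)] at h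
  simpa using h

lemma Weight.char_add {t : SU3} (ht : t ∈ SU3.torus) (μ ν : Weight) :
    (μ + ν).char t = μ.char t * ν.char t := by
  simp only [Weight.char, Prod.fst_add, Prod.snd_add]
  simp only [zpow_add₀ (SU3.torus_apply_ne_zero ht 0), zpow_add₀ (SU3.torus_apply_ne_zero ht 1)]
  ring

lemma Weight.char_ne_zero {t : SU3} (ht : t ∈ SU3.torus) (μ : Weight) : μ.char t ≠ 0 :=
  mul_ne_zero (zpow_ne_zero _ (SU3.torus_apply_ne_zero ht 0))
    (zpow_ne_zero _ (SU3.torus_apply_ne_zero ht 1))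

lemma Weight.char_zero (t : SU3) : (0 : Weight).char t = 1 := by simp [Weight.char]

lemma Weight.char_neg {t : SU3} (ht : t ∈ SU3.torus) (μ : Weight) :
    (-μ).char t = (μ.char t)⁻¹ := by
  refine eq_inv_of_mul_eq_one_left ?_
  rw [← Weight.char_add ht, neg_add_cancel, Weight.char_zero]

lemma Weight.char_nsmul {t : SU3} (ht : t ∈ SU3.torus) (μ : Weight) (k : ℕ) :
    (k • μ).char t = μ.char t ^ k := by
  induction k with
  | zero => simp [Weight.char_zero]
  | succ k ih => rw [succ_nsmul, Weight.char_add ht, ih, pow_succ]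

lemma Weight.conj_char {t : SU3} (ht : t ∈ SU3.torus) (μ : Weight) :
    (starRingEnd ℂ) (μ.char t) = (-μ).char t := by
  rw [Weight.char_neg ht, Weight.char, map_mul, map_zpow₀, map_zpow₀,
    eq_inv_of_mul_eq_one_left (SU3.torus_star_mul ht 0),
    eq_inv_of_mul_eq_one_left (SU3.torus_star_mul ht 1), mul_inv, inv_zpow, inv_zpow]

end Torus

section Roots

variable {H : Type*} [NormedAddCommGroup H] [InnerProductSpace ℂ H] [CompleteSpace H]

lemma coe_map_mul (ρ : SU3 →* unitary (H →L[ℂ] H)) (g h : SU3) :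
    (ρ (g * h) : H →L[ℂ] H) = (ρ g : H →L[ℂ] H) * (ρ h : H →L[ℂ] H) := by
  rw [map_mul]; rfl

lemma coe_map_mul_apply (ρ : SU3 →* unitary (H →L[ℂ] H)) (g h : SU3) (v : H) :
    (ρ (g * h) : H →L[ℂ] H) v = (ρ g : H →L[ℂ] H) ((ρ h : H →L[ℂ] H) v) := by
  rw [map_mul]; rfl

lemma coe_map_one (ρ : SU3 →* unitary (H →L[ℂ] H)) : (ρ 1 : H →L[ℂ] H) = 1 := by
  rw [map_one]; rfl

lemma coe_map_inv (ρ : SU3 →* unitary (H →L[ℂ] H)) (g : SU3) :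
    (ρ g⁻¹ : H →L[ℂ] H) = ContinuousLinearMap.adjoint (ρ g : H →L[ℂ] H) := by
  rw [map_inv]; rfl

lemma map_inv_mul_cancel (ρ : SU3 →* unitary (H →L[ℂ] H)) (g : SU3) :
    (ρ g⁻¹ : H →L[ℂ] H) * (ρ g : H →L[ℂ] H) = 1 := by
  rw [← coe_map_mul, inv_mul_cancel, coe_map_one]

lemma map_mul_inv_cancel (ρ : SU3 →* unitary (H →L[ℂ] H)) (g : SU3) :
    (ρ g : H →L[ℂ] H) * (ρ g⁻¹ : H →L[ℂ] H) = 1 := by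
  rw [← coe_map_mul, mul_inv_cancel, coe_map_one]

lemma inner_map_left (ρ : SU3 →* unitary (H →L[ℂ] H)) (g : SU3) (v w : H) :
    inner ℂ ((ρ g : H →L[ℂ] H) v) w = inner ℂ v ((ρ g⁻¹ : H →L[ℂ] H) w) := by
  rw [coe_map_inv, ContinuousLinearMap.adjoint_inner_right]

/-- An operator on which the torus acts by the character `β` shifts weights by `β`. -/
lemma apply_mem_weightSpace {ρ : SU3 →* unitary (H →L[ℂ] H)} {μ β : Weight} {X : H →L[ℂ] H}
    (hX : ∀ t ∈ SU3.torus, (ρ t : H →L[ℂ] H) * X = β.char t • (X * (ρ t : H →L[ℂ] H)))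
    {v : H} (hv : v ∈ weightSpace ρ μ) : X v ∈ weightSpace ρ (μ + β) := by
  intro t ht
  have h := congrArg (fun Y : H →L[ℂ] H => Y v) (hX t ht)
  simp only [mul_apply_eq_comp, smul_apply] at h
  rw [h, hv t ht, map_smul, smul_smul, Weight.char_add ht, mul_comm]

/-- The adjoint of an operator on which the torus acts by `β` shifts weights by `-β`. -/
lemma adjoint_apply_mem_weightSpace {ρ : SU3 →* unitary (H →L[ℂ] H)} {μ β : Weight}
    {X : H →L[ℂ] H}
    (hX : ∀ t ∈ SU3.torus, (ρ t : H →L[ℂ] H) * X = β.char t • (X * (ρ t : H →L[ℂ] H)))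
    {v : H} (hv : v ∈ weightSpace ρ μ) :
    ContinuousLinearMap.adjoint X v ∈ weightSpace ρ (μ + -β) := by
  refine apply_mem_weightSpace (fun t ht => ?_) hv
  have h := hX t ht
  have h2 : X * (ρ t⁻¹ : H →L[ℂ] H) = β.char t • ((ρ t⁻¹ : H →L[ℂ] H) * X) := by
    calc X * (ρ t⁻¹ : H →L[ℂ] H)
        = (ρ t⁻¹ : H →L[ℂ] H) * ((ρ t : H →L[ℂ] H) * X) * (ρ t⁻¹ : H →L[ℂ] H) := by
          rw [← mul_assoc, map_inv_mul_cancel, one_mul]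
      _ = β.char t • ((ρ t⁻¹ : H →L[ℂ] H) * X *
            ((ρ t : H →L[ℂ] H) * (ρ t⁻¹ : H →L[ℂ] H))) := by
          rw [h]; simp only [mul_smul_comm, smul_mul_assoc, mul_assoc]
      _ = _ := by rw [map_mul_inv_cancel, mul_one]
  have h3 := congrArg star h2
  rw [star_mul, star_smul, star_mul, coe_map_inv, ← ContinuousLinearMap.star_eq_adjoint,
    star_star] at h3
  rw [← Weight.conj_char ht]
  exact h3

section Derivatives

lemma ContinuousLinearMap.iteratedDeriv_comp {E F : Type*} [NormedAddCommGroup E]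
    [NormedSpace ℂ E] [NormedAddCommGroup F] [NormedSpace ℂ F] (L : E →L[ℂ] F) {f : ℂ → E}
    (hf : ContDiff ℂ ∞ f) (n : ℕ) (x : ℂ) :
    iteratedDeriv n (fun s => L (f s)) x = L (iteratedDeriv n f x) := by
  rw [iteratedDeriv_eq_iteratedFDeriv, iteratedDeriv_eq_iteratedFDeriv]
  have := L.iteratedFDeriv_comp_left (x := x) (i := n) hf.contDiffAt (by exact_mod_cast le_top)
  change iteratedFDeriv ℂ n (L ∘ f) x _ = _
  rw [this]
  rfl

/-- Only the constant term of the Taylor series at `0` survives. -/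
lemma eq_of_iteratedDeriv_eq_zero {E : Type*} [NormedAddCommGroup E] [NormedSpace ℂ E]
    [CompleteSpace E] {f : ℂ → E} (hf : Differentiable ℂ f)
    (h : ∀ n ≠ 0, iteratedDeriv n f 0 = 0) (s : ℂ) : f s = f 0 := by
  rw [← Complex.taylorSeries_eq_of_entire hf 0 s, tsum_eq_single 0 fun n hn => by simp [h n hn]]
  simp

end Derivatives

attribute [local instance] Matrix.normedAddCommGroup Matrix.normedSpace

lemma contDiff_transvection (i j : Fin 3) :
    ContDiff ℂ ∞ fun s : ℂ => Matrix.transvection i j s := by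
  refine contDiff_pi.2 fun k => contDiff_pi.2 fun l => ?_
  simp only [Matrix.transvection, Matrix.add_apply, Matrix.single_apply]
  by_cases h : i = k ∧ j = l
  · simp only [if_pos h]
    fun_prop
  · simp only [if_neg h]
    fun_prop

/-- Conjugating by `t` multiplies `E_ij` by `t_i / t_j`, the value `c` of the corresponding root. -/
lemma SU3.mul_transvection {t : SU3} (ht : t ∈ SU3.torus) {i j : Fin 3} {c : ℂ}
    (hc : c * t.1 j j = t.1 i i) (s : ℂ) :
    t.1 * Matrix.transvection i j s = Matrix.transvection i j (c * s) * t.1 := by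
  simp only [Matrix.transvection, mul_add, add_mul, mul_one, one_mul]
  congr 1
  ext k l
  rw [Matrix.mul_apply, Matrix.mul_apply,
    Finset.sum_eq_single k (fun b _ hb => by rw [SU3.torus_apply_of_ne ht hb.symm, zero_mul])
      (by simp),
    Finset.sum_eq_single l (fun b _ hb => by rw [SU3.torus_apply_of_ne ht hb, mul_zero]) (by simp)]
  simp only [Matrix.single_apply]
  split_ifs with h
  · obtain ⟨rfl, rfl⟩ := h
    linear_combination -s * hc
  · simp

/-- `P` is a smooth (over `ℂ`) extension of `ρ` to all matrices. -/
structure IsExtension (ρ : SU3 →* unitary (H →L[ℂ] H))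
    (P : Matrix (Fin 3) (Fin 3) ℂ → (H →L[ℂ] H)) : Prop where
  contDiff : ContDiff ℂ ∞ P
  apply_coe : ∀ g : SU3, P g.1 = (ρ g : H →L[ℂ] H)

variable {ρ : SU3 →* unitary (H →L[ℂ] H)} {P : Matrix (Fin 3) (Fin 3) ℂ → (H →L[ℂ] H)}

lemma IsExtension.differentiable (hP : IsExtension ρ P) : Differentiable ℂ P :=
  hP.contDiff.differentiable (by simp)

/-- The identity principle, applied in each variable separately. -/
lemma IsExtension.map_mul (hP : IsExtension ρ P) {M N : Matrix (Fin 3) (Fin 3) ℂ}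
    (hM : M ∈ SU3.hull) (hN : N ∈ SU3.hull) : P (M * N) = P M * P N := by
  have hd := hP.differentiable
  refine SU3.eq_of_mem_hull (f₁ := fun M => P (M * N)) (f₂ := fun M => P M * P N)
    (hd.comp (differentiable_id.matrix_mul (differentiable_const N))) (by fun_prop)
    (fun g => ?_) hM
  refine SU3.eq_of_mem_hull (f₁ := fun N => P (g.1 * N)) (f₂ := fun N => P g.1 * P N)
    (hd.comp ((differentiable_const g.1).matrix_mul differentiable_id)) (by fun_prop)
    (fun k => ?_) hN
  have := hP.apply_coe (g * k)
  rw [coe_map_mul, ← hP.apply_coe, ← hP.apply_coe] at this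
  exact this

lemma IsExtension.map_one (hP : IsExtension ρ P) : P 1 = 1 := by
  have := hP.apply_coe 1
  rwa [coe_map_one] at this

/-- Conjugation by `t` rescales the parameter `s` by `α(t)`, hence the `n`-th derivative at `0` by
`α(t)^n`. These derivatives play the role of powers of root vectors of the Lie algebra. -/
lemma IsExtension.torus_mul_iteratedDeriv (hP : IsExtension ρ P) {i j : Fin 3} (hij : i ≠ j)
    {α : Weight} (hα : ∀ t ∈ SU3.torus, α.char t * t.1 j j = t.1 i i) (n : ℕ) {t : SU3}
    (ht : t ∈ SU3.torus) :
    (ρ t : H →L[ℂ] H) * iteratedDeriv n (fun s => P (Matrix.transvection i j s)) 0 =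
      (n • α).char t •
        (iteratedDeriv n (fun s => P (Matrix.transvection i j s)) 0 * (ρ t : H →L[ℂ] H)) := by
  have hF : ContDiff ℂ ∞ fun s => P (Matrix.transvection i j s) :=
    hP.contDiff.comp (contDiff_transvection i j)
  have h1 := (ContinuousLinearMap.mul ℂ (H →L[ℂ] H) (ρ t : H →L[ℂ] H)).iteratedDeriv_comp hF n 0
  have hF' : ContDiff ℂ ∞ fun s => P (Matrix.transvection i j (α.char t * s)) :=
    hF.comp (contDiff_const.mul contDiff_id)
  have h2 := ((ContinuousLinearMap.mul ℂ (H →L[ℂ] H)).flip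
    (ρ t : H →L[ℂ] H)).iteratedDeriv_comp hF' n 0
  have h3 := congrFun (iteratedDeriv_comp_const_smul (n := n)
    (hF.of_le (by exact_mod_cast le_top)) (α.char t)) 0
  simp only [ContinuousLinearMap.mul_apply', ContinuousLinearMap.flip_apply] at h1 h2
  rw [← h1, Weight.char_nsmul ht, ← smul_mul_assoc]
  simp only [mul_zero] at h3
  rw [← h3, ← h2]
  congr 1
  funext s
  rw [← hP.apply_coe, ← hP.map_mul (SU3.coe_mem_hull t) (SU3.transvection_mem_hull hij s),
    SU3.mul_transvection ht (hα t ht) s,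
    hP.map_mul (SU3.transvection_mem_hull hij _) (SU3.coe_mem_hull t)]

/-- If no `μ + k α`, `k ≥ 1`, is a weight, then the root subgroup of `α` fixes the vectors of
weight `μ`. -/
lemma IsExtension.transvection_apply (hP : IsExtension ρ P) {i j : Fin 3} (hij : i ≠ j)
    {α μ : Weight} (hα : ∀ t ∈ SU3.torus, α.char t * t.1 j j = t.1 i i)
    (hμ : ∀ n : ℕ, n ≠ 0 → weightSpace ρ (μ + n • α) = ⊥) {v : H} (hv : v ∈ weightSpace ρ μ)
    (s : ℂ) : P (Matrix.transvection i j s) v = v := by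
  have hF : ContDiff ℂ ∞ fun s => P (Matrix.transvection i j s) :=
    hP.contDiff.comp (contDiff_transvection i j)
  have h := eq_of_iteratedDeriv_eq_zero (f := fun s => P (Matrix.transvection i j s) v)
    ((hF.differentiable (by simp)).clm_apply (differentiable_const v)) (fun n hn => ?_) s
  · simpa [hP.map_one] using h
  · have h1 := (ContinuousLinearMap.apply ℂ H v).iteratedDeriv_comp hF n 0
    simp only [ContinuousLinearMap.apply_apply] at h1
    rw [h1, ← Submodule.mem_bot ℂ, ← hμ n hn]
    exact apply_mem_weightSpace (fun t ht => hP.torus_mul_iteratedDeriv hij hα n ht) hv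

/-- If no `μ + k α`, `k ≥ 1`, is a weight, then the root subgroup of `-α` fixes the functionals
`⟪v, ·⟫` with `v` of weight `μ`. -/
lemma IsExtension.inner_transvection_apply (hP : IsExtension ρ P) {i j : Fin 3} (hij : i ≠ j)
    {α μ : Weight} (hα : ∀ t ∈ SU3.torus, α.char t * t.1 j j = t.1 i i)
    (hμ : ∀ n : ℕ, n ≠ 0 → weightSpace ρ (μ + n • α) = ⊥) {v : H} (hv : v ∈ weightSpace ρ μ)
    (w : H) (s : ℂ) : inner ℂ v (P (Matrix.transvection j i s) w) = inner ℂ v w := by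
  have hF : ContDiff ℂ ∞ fun s => P (Matrix.transvection j i s) :=
    hP.contDiff.comp (contDiff_transvection j i)
  have hα' : ∀ t ∈ SU3.torus, (-α).char t * t.1 i i = t.1 j j := by
    intro t ht
    rw [Weight.char_neg ht, ← hα t ht, inv_mul_cancel_left₀ (Weight.char_ne_zero ht α)]
  let L : (H →L[ℂ] H) →L[ℂ] ℂ := (innerSL ℂ v).comp (ContinuousLinearMap.apply ℂ H w)
  have h := eq_of_iteratedDeriv_eq_zero (f := fun s => L (P (Matrix.transvection j i s)))
    (L.differentiable.comp (hF.differentiable (by simp))) (fun n hn => ?_) s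
  · simpa [hP.map_one, L] using h
  · rw [L.iteratedDeriv_comp hF n 0]
    change inner ℂ v
      (iteratedDeriv n (fun s => P (Matrix.transvection j i s)) 0 w) = 0
    -- The `n`-th derivative along the root `-α` lowers weights by `nα`, so its adjoint raises them
    -- and must kill `v`.
    have hmem := adjoint_apply_mem_weightSpace
      (fun t ht => hP.torus_mul_iteratedDeriv hij.symm hα' n ht) hv
    rw [smul_neg, neg_neg, hμ n hn, Submodule.mem_bot] at hmem
    rw [← ContinuousLinearMap.adjoint_inner_left, hmem,
      inner_zero_left]

end Roots

/-! ### The big cell and vectors of highest weight -/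

section BigCell

attribute [local instance] Matrix.normedAddCommGroup Matrix.normedSpace

/-- Upper unipotent matrices. -/
def Matrix.upperUnipotent (a b c : ℂ) : Matrix (Fin 3) (Fin 3) ℂ := !![1, a, b; 0, 1, c; 0, 0, 1]

/-- Lower unipotent matrices. -/
def Matrix.lowerUnipotent (a b c : ℂ) : Matrix (Fin 3) (Fin 3) ℂ := !![1, 0, 0; a, 1, 0; b, c, 1]

lemma Matrix.upperUnipotent_eq (a b c : ℂ) : Matrix.upperUnipotent a b c =
    Matrix.transvection 1 2 c * Matrix.transvection 0 2 b * Matrix.transvection 0 1 a := by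
  ext k l
  fin_cases k <;> fin_cases l <;>
    simp [Matrix.upperUnipotent, Matrix.mul_apply, Fin.sum_univ_three, Matrix.transvection,
      Matrix.single]

lemma Matrix.lowerUnipotent_eq (a b c : ℂ) : Matrix.lowerUnipotent a b c =
    Matrix.transvection 1 0 a * Matrix.transvection 2 0 b * Matrix.transvection 2 1 c := by
  ext k l
  fin_cases k <;> fin_cases l <;>
    simp [Matrix.lowerUnipotent, Matrix.mul_apply, Fin.sum_univ_three, Matrix.transvection,
      Matrix.single]

lemma SU3.upperUnipotent_mem_hull (a b c : ℂ) : Matrix.upperUnipotent a b c ∈ SU3.hull := by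
  rw [Matrix.upperUnipotent_eq]
  exact SU3.hull.mul_mem (SU3.hull.mul_mem (SU3.transvection_mem_hull (by decide) c)
    (SU3.transvection_mem_hull (by decide) b)) (SU3.transvection_mem_hull (by decide) a)

lemma SU3.lowerUnipotent_mem_hull (a b c : ℂ) : Matrix.lowerUnipotent a b c ∈ SU3.hull := by
  rw [Matrix.lowerUnipotent_eq]
  exact SU3.hull.mul_mem (SU3.hull.mul_mem (SU3.transvection_mem_hull (by decide) a)
    (SU3.transvection_mem_hull (by decide) b)) (SU3.transvection_mem_hull (by decide) c)

/-- The elements of the complexified torus, with logarithmic coordinates. -/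
def Matrix.torusExp (θ φ : ℂ) : Matrix (Fin 3) (Fin 3) ℂ :=
  !![Complex.exp (θ * Complex.I), 0, 0; 0, Complex.exp (φ * Complex.I), 0;
    0, 0, Complex.exp (-((θ + φ) * Complex.I))]

lemma differentiable_torusExp {θ φ : ℂ → ℂ} (hθ : Differentiable ℂ θ)
    (hφ : Differentiable ℂ φ) : Differentiable ℂ fun s => Matrix.torusExp (θ s) (φ s) := by
  have hE : Differentiable ℂ Complex.exp := Complex.differentiable_exp
  refine differentiable_matrix fun i j => ?_
  fin_cases i <;> fin_cases j <;> simp [Matrix.torusExp] <;> fun_prop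

lemma Matrix.exists_torusExp_eq {x y z : ℂ} (h : x * y * z = 1) :
    ∃ θ φ, Matrix.torusExp θ φ = !![x, 0, 0; 0, y, 0; 0, 0, z] := by
  have hexp : ∀ w : ℂ, w ≠ 0 → ∃ φ : ℂ, Complex.exp (φ * Complex.I) = w := fun w hw =>
    ⟨-(Complex.log w * Complex.I), by
      rw [neg_mul, mul_assoc, Complex.I_mul_I]; simp [Complex.exp_log hw]⟩
  obtain ⟨θ, hθ⟩ := hexp x (by rintro rfl; simp at h)
  obtain ⟨φ, hφ⟩ := hexp y (by rintro rfl; simp at h)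
  refine ⟨θ, φ, ?_⟩
  have hz : Complex.exp (-((θ + φ) * Complex.I)) = z := by
    rw [Complex.exp_neg, add_mul, Complex.exp_add, hθ, hφ]
    exact (eq_inv_of_mul_eq_one_right h).symm
  rw [Matrix.torusExp, hθ, hφ, hz]

lemma SU3.exists_coe_eq_torusExp (θ φ : ℝ) :
    ∃ t ∈ SU3.torus, t.1 = Matrix.torusExp θ φ := by
  have h : ∀ x y : ℂ, x + y = 0 → Complex.exp x * Complex.exp y = 1 := fun x y h => by
    rw [← Complex.exp_add, h, Complex.exp_zero]
  refine ⟨⟨Matrix.torusExp θ φ, Matrix.mem_specialUnitaryGroup_iff.2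
    ⟨Matrix.mem_unitaryGroup_iff.2 ?_, ?_⟩⟩, ?_, rfl⟩
  · ext i j
    fin_cases i <;> fin_cases j <;>
      simp [Matrix.torusExp, Matrix.mul_apply, Fin.sum_univ_three, Matrix.star_apply,
        ← Complex.exp_conj] <;> exact h _ _ (by ring)
  · simp only [Matrix.torusExp, Matrix.det_fin_three]
    simp
    rw [mul_assoc, ← Complex.exp_add, ← Complex.exp_add, ← Complex.exp_zero]
    congr 1
    ring
  · intro i j hij
    fin_cases i <;> fin_cases j <;> simp [Matrix.torusExp] at hij ⊢

lemma SU3.torusExp_mem_hull (θ φ : ℂ) : Matrix.torusExp θ φ ∈ SU3.hull := by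
  intro f hf h
  refine Differentiable.eq_zero_of_ofReal (f := fun θ => f (Matrix.torusExp θ φ))
    (hf.comp (differentiable_torusExp (by fun_prop) (by fun_prop))) (fun θ => ?_) θ
  refine Differentiable.eq_zero_of_ofReal (f := fun φ => f (Matrix.torusExp θ φ))
    (hf.comp (differentiable_torusExp (by fun_prop) (by fun_prop))) (fun φ => ?_) φ
  obtain ⟨t, -, ht⟩ := SU3.exists_coe_eq_torusExp θ φ
  exact ht ▸ h t

/-- The `LDU` factorization of a matrix of determinant `1` with nonzero leading minors. -/
lemma Matrix.exists_lower_mul_torusExp_mul_upper {M : Matrix (Fin 3) (Fin 3) ℂ} (hM : M.det = 1)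
    (h1 : M 0 0 ≠ 0) (h2 : M 0 0 * M 1 1 - M 0 1 * M 1 0 ≠ 0) :
    ∃ a b c θ φ a' b' c', M = Matrix.lowerUnipotent a b c *
      (Matrix.torusExp θ φ * Matrix.upperUnipotent a' b' c') := by
  set d := M 0 0 * M 1 1 - M 0 1 * M 1 0 with hd
  obtain ⟨θ, φ, hD⟩ := Matrix.exists_torusExp_eq (x := M 0 0) (y := d / M 0 0) (z := d⁻¹)
    (by field_simp)
  refine ⟨M 1 0 / M 0 0, M 2 0 / M 0 0, (M 0 0 * M 2 1 - M 0 1 * M 2 0) / d, θ, φ,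
    M 0 1 / M 0 0, M 0 2 / M 0 0, (M 0 0 * M 1 2 - M 0 2 * M 1 0) / d, ?_⟩
  rw [hD]
  rw [Matrix.det_fin_three] at hM
  ext i j
  fin_cases i <;> fin_cases j <;>
    simp [Matrix.lowerUnipotent, Matrix.upperUnipotent, Matrix.mul_apply, Fin.sum_univ_three]
      <;> field_simp
  · rw [hd]; ring
  · ring
  · ring
  · linear_combination M 0 0 * hM - M 2 2 * M 0 0 * hd

/-- Every element of `SU(3)` is the value at `0` of a polynomial curve in the hull which generically
lies in the big cell. -/
lemma SU3.exists_dense_leading_minors_ne_zero (g : SU3) :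
    Dense {s : ℂ | (Matrix.upperUnipotent s (s ^ 3) s * g.1) 0 0 ≠ 0 ∧
      (Matrix.upperUnipotent s (s ^ 3) s * g.1) 0 0 *
        (Matrix.upperUnipotent s (s ^ 3) s * g.1) 1 1 -
      (Matrix.upperUnipotent s (s ^ 3) s * g.1) 0 1 *
        (Matrix.upperUnipotent s (s ^ 3) s * g.1) 1 0 ≠ 0} := by
  have hdet := g.det_eq_one
  rw [Matrix.det_fin_three] at hdet
  obtain ⟨M, hM⟩ : ∃ M, M = g.1 := ⟨_, rfl⟩
  rw [← hM] at hdet ⊢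
  -- The two leading minors as polynomials in `s`. The exponents are chosen so that the coefficients
  -- of degrees 0, 1 and 3 isolate the entries of the first column, respectively (up to sign) the
  -- minors of the first two columns. With `s ^ 2` as the corner entry the `m₂` terms would cancel.
  -- Were all three coefficients zero, the determinant would vanish.
  let q₁ : Polynomial ℂ := Polynomial.C (M 0 0) + Polynomial.C (M 1 0) * Polynomial.X +
    Polynomial.C (M 2 0) * Polynomial.X ^ 3
  let m₀ := M 0 0 * M 1 1 - M 0 1 * M 1 0
  let m₁ := M 0 0 * M 2 1 - M 0 1 * M 2 0
  let m₂ := M 1 0 * M 2 1 - M 1 1 * M 2 0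
  let q₂ : Polynomial ℂ := Polynomial.C m₀ + Polynomial.C m₁ * Polynomial.X +
    Polynomial.C m₂ * (Polynomial.X ^ 2 - Polynomial.X ^ 3)
  have hq₁ : q₁ ≠ 0 := by
    intro h
    have h0 := congrArg (Polynomial.coeff · 0) h
    have h1 := congrArg (Polynomial.coeff · 1) h
    have h3 := congrArg (Polynomial.coeff · 3) h
    simp [q₁, Polynomial.coeff_X, Polynomial.coeff_X_pow, Polynomial.coeff_C] at h0 h1 h3
    rw [h0, h1, h3] at hdet
    simp at hdet
  have hq₂ : q₂ ≠ 0 := by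
    intro h
    have h0 := congrArg (Polynomial.coeff · 0) h
    have h1 := congrArg (Polynomial.coeff · 1) h
    have h3 := congrArg (Polynomial.coeff · 3) h
    simp [q₂, Polynomial.coeff_X, Polynomial.coeff_X_pow, Polynomial.coeff_C] at h0 h1 h3
    have : M 2 2 * m₀ - M 1 2 * m₁ + M 0 2 * m₂ = 1 := by
      simp only [m₀, m₁, m₂]
      linear_combination hdet
    rw [h0, h1, h3] at this
    simp at this
  have hfin := Polynomial.finite_setOfPred_isRoot (mul_ne_zero hq₁ hq₂)
  refine (hfin.countable.dense_compl ℂ).mono fun s hs => ?_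
  have hs' : q₁.eval s * q₂.eval s ≠ 0 := by
    rw [← Polynomial.eval_mul]
    exact hs
  have e₁ : q₁.eval s = (Matrix.upperUnipotent s (s ^ 3) s * M) 0 0 := by
    simp [q₁, Matrix.upperUnipotent, Matrix.mul_apply, Fin.sum_univ_three]
    ring
  have e₂ : q₂.eval s = (Matrix.upperUnipotent s (s ^ 3) s * M) 0 0 *
        (Matrix.upperUnipotent s (s ^ 3) s * M) 1 1 -
      (Matrix.upperUnipotent s (s ^ 3) s * M) 0 1 *
        (Matrix.upperUnipotent s (s ^ 3) s * M) 1 0 := by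
    simp [q₂, m₀, m₁, m₂, Matrix.upperUnipotent, Matrix.mul_apply, Fin.sum_univ_three]
    ring
  rw [e₁, e₂] at hs'
  exact mul_ne_zero_iff.1 hs'

end BigCell

/-! ### Highest weight vectors: unipotent invariance, multiplicity one, and coherent states. -/

section HighestWeight

attribute [local instance] Matrix.normedAddCommGroup Matrix.normedSpace

variable {H : Type*} [NormedAddCommGroup H] [InnerProductSpace ℂ H] [CompleteSpace H]
  {ρ : SU3 →* unitary (H →L[ℂ] H)} {P : Matrix (Fin 3) (Fin 3) ℂ → (H →L[ℂ] H)}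

/-- Both sides are entire in each angle and agree for real angles, where the matrix lies in the
torus. -/
lemma IsExtension.torusExp_apply (hP : IsExtension ρ P) {μ : Weight} {v : H}
    (hv : v ∈ weightSpace ρ μ) (θ φ : ℂ) :
    P (Matrix.torusExp θ φ) v = Complex.exp (((μ.1 + μ.2 : ℤ) : ℂ) * (θ * Complex.I) +
      (μ.2 : ℂ) * (φ * Complex.I)) • v := by
  have hE : Differentiable ℂ Complex.exp := Complex.differentiable_exp
  have hd := hP.differentiable
  rw [← sub_eq_zero]
  refine Differentiable.eq_zero_of_ofReal (f := fun θ => P (Matrix.torusExp θ φ) v -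
    Complex.exp (((μ.1 + μ.2 : ℤ) : ℂ) * (θ * Complex.I) + (μ.2 : ℂ) * (φ * Complex.I)) • v)
    (((hd.comp (differentiable_torusExp (by fun_prop) (by fun_prop))).clm_apply
      (differentiable_const v)).sub (by fun_prop)) (fun θ => ?_) θ
  refine Differentiable.eq_zero_of_ofReal (f := fun φ => P (Matrix.torusExp θ φ) v -
    Complex.exp (((μ.1 + μ.2 : ℤ) : ℂ) * (θ * Complex.I) + (μ.2 : ℂ) * (φ * Complex.I)) • v)
    (((hd.comp (differentiable_torusExp (by fun_prop) (by fun_prop))).clm_apply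
      (differentiable_const v)).sub (by fun_prop)) (fun φ => ?_) φ
  obtain ⟨t, htT, ht⟩ := SU3.exists_coe_eq_torusExp θ φ
  rw [← ht, hP.apply_coe, hv t htT, sub_eq_zero, Weight.char, ht, Complex.exp_add,
    Complex.exp_int_mul, Complex.exp_int_mul]
  simp [Matrix.torusExp]

/-- The three values of `α` are the positive roots; raising a highest weight along one of them
violates its maximality. -/
lemma IsHighestWeight.weightSpace_add_nsmul {μ α : Weight} (hμ : IsHighestWeight ρ μ)
    (hα : α = (2, -1) ∨ α = (-1, 2) ∨ α = (1, 1)) (n : ℕ) (hn : n ≠ 0) :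
    weightSpace ρ (μ + n • α) = ⊥ := by
  by_contra h
  obtain ⟨c₁, c₂, hc⟩ := hμ.2 _ h
  have h1 := congrArg Prod.fst hc
  have h2 := congrArg Prod.snd hc
  rcases hα with rfl | rfl | rfl <;> simp [simpleRoot₁, simpleRoot₂] at h1 h2 <;> omega

lemma SU3.torus_char_simpleRoot₁ : ∀ t ∈ SU3.torus,
    Weight.char (2, -1) t * t.1 1 1 = t.1 0 0 := by
  intro t ht
  have := SU3.torus_apply_ne_zero ht 1
  simp [Weight.char, zpow_neg, this]

lemma SU3.torus_char_simpleRoot₂ : ∀ t ∈ SU3.torus,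
    Weight.char (-1, 2) t * t.1 2 2 = t.1 1 1 := by
  intro t ht
  have := SU3.torus_prod ht
  simp [Weight.char]
  linear_combination t.1 1 1 * this

lemma SU3.torus_char_add_simpleRoots : ∀ t ∈ SU3.torus,
    Weight.char (1, 1) t * t.1 2 2 = t.1 0 0 := by
  intro t ht
  have := SU3.torus_prod ht
  simp [Weight.char]
  linear_combination t.1 0 0 * this

lemma IsExtension.upperUnipotent_apply (hP : IsExtension ρ P) {μ : Weight}
    (hμ : IsHighestWeight ρ μ) {v : H} (hv : v ∈ weightSpace ρ μ) (a b c : ℂ) :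
    P (Matrix.upperUnipotent a b c) v = v := by
  have h : ∀ {i j : Fin 3}, i ≠ j → ∀ s, Matrix.transvection i j s ∈ SU3.hull :=
    fun hij s => SU3.transvection_mem_hull hij s
  rw [Matrix.upperUnipotent_eq, hP.map_mul (SU3.hull.mul_mem (h (by decide) c) (h (by decide) b))
    (h (by decide) a), hP.map_mul (h (by decide) c) (h (by decide) b)]
  simp only [mul_apply_eq_comp]
  rw [hP.transvection_apply (by decide) SU3.torus_char_simpleRoot₁
      (hμ.weightSpace_add_nsmul (by simp)) hv,
    hP.transvection_apply (by decide) SU3.torus_char_add_simpleRoots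
      (hμ.weightSpace_add_nsmul (by simp)) hv,
    hP.transvection_apply (by decide) SU3.torus_char_simpleRoot₂
      (hμ.weightSpace_add_nsmul (by simp)) hv]

lemma IsExtension.inner_lowerUnipotent_apply (hP : IsExtension ρ P) {μ : Weight}
    (hμ : IsHighestWeight ρ μ) {v : H} (hv : v ∈ weightSpace ρ μ) (w : H) (a b c : ℂ) :
    inner ℂ v (P (Matrix.lowerUnipotent a b c) w) = inner ℂ v w := by
  have h : ∀ {i j : Fin 3}, i ≠ j → ∀ s, Matrix.transvection i j s ∈ SU3.hull :=
    fun hij s => SU3.transvection_mem_hull hij s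
  rw [Matrix.lowerUnipotent_eq, hP.map_mul (SU3.hull.mul_mem (h (by decide) a) (h (by decide) b))
    (h (by decide) c), hP.map_mul (h (by decide) a) (h (by decide) b)]
  simp only [mul_apply_eq_comp]
  rw [hP.inner_transvection_apply (by decide) SU3.torus_char_simpleRoot₁
      (hμ.weightSpace_add_nsmul (by simp)) hv,
    hP.inner_transvection_apply (by decide) SU3.torus_char_add_simpleRoots
      (hμ.weightSpace_add_nsmul (by simp)) hv,
    hP.inner_transvection_apply (by decide) SU3.torus_char_simpleRoot₂
      (hμ.weightSpace_add_nsmul (by simp)) hv]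

/-- A submodule stable under an irreducible representation is trivial. -/
lemma eq_top_of_irreducible (hρ : (toRepresentation ρ).IsIrreducible) (W : Submodule ℂ H)
    (hW : ∀ (g : SU3), ∀ u ∈ W, (ρ g : H →L[ℂ] H) u ∈ W) (h0 : W ≠ ⊥) : W = ⊤ := by
  let W' : Subrepresentation (toRepresentation ρ) := ⟨W, fun g u hu => hW g u hu⟩
  rcases hρ.eq_bot_or_eq_top W' with h | h
  · exact absurd (congrArg Subrepresentation.toSubmodule h) h0
  · exact congrArg Subrepresentation.toSubmodule h

/-- An orbit of a nonzero vector spans. -/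
lemma eq_zero_of_inner_orbit (hρ : (toRepresentation ρ).IsIrreducible) {v w : H} (hv : v ≠ 0)
    (h : ∀ g : SU3, inner ℂ w ((ρ g : H →L[ℂ] H) v) = 0) : w = 0 := by
  let W : Submodule ℂ H :=
    { carrier := {u | ∀ g : SU3, inner ℂ w ((ρ g : H →L[ℂ] H) u) = 0}
      zero_mem' := by simp
      add_mem' := by
        intro a b ha hb g
        rw [map_add, inner_add_right, ha g, hb g, add_zero]
      smul_mem' := by
        intro c a ha g
        rw [map_smul, inner_smul_right, ha g, mul_zero] }
  have hW : W = ⊤ := by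
    refine eq_top_of_irreducible hρ W (fun g u hu k => ?_) ?_
    · rw [← coe_map_mul_apply]
      exact hu _
    · exact fun hb => hv ((Submodule.mem_bot ℂ).1 (hb ▸ (show v ∈ W from h)))
  have hw : w ∈ W := hW ▸ Submodule.mem_top
  have := hw 1
  rw [coe_map_one] at this
  exact inner_self_eq_zero.1 this

/-- The lower unipotent translates of a highest weight vector span. -/
lemma IsExtension.eq_zero_of_inner_lowerUnipotent (hP : IsExtension ρ P)
    (hρ : (toRepresentation ρ).IsIrreducible) {μ : Weight} (hμ : IsHighestWeight ρ μ) {v w : H}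
    (hv : v ∈ weightSpace ρ μ) (hv0 : v ≠ 0)
    (h : ∀ a b c : ℂ, inner ℂ w (P (Matrix.lowerUnipotent a b c) v) = 0) : w = 0 := by
  -- On the big cell the upper factor fixes `v` and the torus factor scales it, so only the lower
  -- factor matters. Density and continuity then give every `g`, as the value at `s = 0` of a curve
  -- generically in the cell.
  have hcell : ∀ M ∈ SU3.hull, M 0 0 ≠ 0 → M 0 0 * M 1 1 - M 0 1 * M 1 0 ≠ 0 →
      inner ℂ w (P M v) = 0 := by
    intro M hM h1 h2
    obtain ⟨a, b, c, θ, φ, a', b', c', rfl⟩ :=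
      Matrix.exists_lower_mul_torusExp_mul_upper (SU3.det_of_mem_hull hM) h1 h2
    have hU := SU3.upperUnipotent_mem_hull a' b' c'
    have hD := SU3.torusExp_mem_hull θ φ
    rw [hP.map_mul (SU3.lowerUnipotent_mem_hull a b c) (SU3.hull.mul_mem hD hU),
      hP.map_mul hD hU]
    simp only [mul_apply_eq_comp]
    rw [hP.upperUnipotent_apply hμ hv, hP.torusExp_apply hv, map_smul, inner_smul_right, h,
      mul_zero]
  refine eq_zero_of_inner_orbit hρ hv0 fun g => ?_
  have hU : Differentiable ℂ fun s : ℂ => Matrix.upperUnipotent s (s ^ 3) s := by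
    refine differentiable_matrix fun i j => ?_
    fin_cases i <;> fin_cases j <;> simp [Matrix.upperUnipotent]
  have hc : Continuous fun s : ℂ => P (Matrix.upperUnipotent s (s ^ 3) s * g.1) v :=
    ((hP.differentiable.comp (hU.matrix_mul (differentiable_const g.1))).clm_apply
      (differentiable_const v)).continuous
  have key := Continuous.ext_on (SU3.exists_dense_leading_minors_ne_zero g)
    (f := fun s => inner ℂ w (P (Matrix.upperUnipotent s (s ^ 3) s * g.1) v)) (g := fun _ => 0)
    (continuous_const.inner hc) continuous_const fun s hs =>
      hcell _ (SU3.hull.mul_mem (SU3.upperUnipotent_mem_hull _ _ _) (SU3.coe_mem_hull g)) hs.1 hs.2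
  have h0 := congrFun key 0
  have h1 : Matrix.upperUnipotent 0 (0 ^ 3) 0 = 1 := by
    ext i j
    fin_cases i <;> fin_cases j <;> simp [Matrix.upperUnipotent]
  simp only [h1, one_mul, hP.apply_coe] at h0
  exact h0

/-- The highest weight has multiplicity one. -/
lemma IsExtension.weightSpace_eq_span (hP : IsExtension ρ P)
    (hρ : (toRepresentation ρ).IsIrreducible) {μ : Weight} (hμ : IsHighestWeight ρ μ) {v : H}
    (hv : v ∈ weightSpace ρ μ) (hv0 : v ≠ 0) : weightSpace ρ μ = Submodule.span ℂ {v} := by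
  refine le_antisymm (fun u hu => ?_) ((Submodule.span_singleton_le_iff_mem _ _).2 hv)
  -- The component of `u` orthogonal to `v` is again of highest weight, so pairing with it ignores
  -- lower unipotents: it is orthogonal to every `P L v`.
  have hmem : u - (ℂ ∙ v).starProjection u ∈ weightSpace ρ μ := by
    refine sub_mem hu ((Submodule.span_singleton_le_iff_mem _ _).2 hv ?_)
    exact Submodule.starProjection_apply_mem _ _
  have h0 : u - (ℂ ∙ v).starProjection u = 0 := by
    refine hP.eq_zero_of_inner_lowerUnipotent hρ hμ hv hv0 fun a b c => ?_
    rw [hP.inner_lowerUnipotent_apply hμ hmem]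
    exact Submodule.starProjection_inner_eq_zero u v (Submodule.mem_span_singleton_self v)
  rw [sub_eq_zero.1 h0]
  exact Submodule.starProjection_apply_mem _ _

/-- The diagonal matrix elements of an operator in the coherent states determine it. -/
lemma IsExtension.eq_zero_of_inner_coherent (hP : IsExtension ρ P)
    (hρ : (toRepresentation ρ).IsIrreducible) {μ : Weight} (hμ : IsHighestWeight ρ μ) {v : H}
    (hv : v ∈ weightSpace ρ μ) (hv0 : v ≠ 0) {A : H →L[ℂ] H}
    (hA : ∀ g : SU3, inner ℂ ((ρ g : H →L[ℂ] H) v) (A ((ρ g : H →L[ℂ] H) v)) = 0) : A = 0 := by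
  have hd := hP.differentiable
  have hadj : Differentiable ℂ fun M : Matrix (Fin 3) (Fin 3) ℂ => M.adjugate :=
    differentiable_matrix fun i j => (contDiff_matrix_adjugate i j).differentiable (by simp)
  have hadjmem : ∀ M ∈ SU3.hull, M.adjugate ∈ SU3.hull := by
    intro M hM f hf h
    refine hM (fun M => f M.adjugate) (hf.comp hadj) fun g => ?_
    have := h g⁻¹
    rwa [SU3.coe_inv, ← SU3.adjugate_eq_star] at this
  -- With `ρ(g)` moved across the inner product as an inverse, and the inverse written as an
  -- adjugate, the hypothesis becomes holomorphic in `g` and extends to the hull.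
  have h1 : ∀ M ∈ SU3.hull, inner ℂ v (P M.adjugate (A (P M v))) = 0 := by
    intro M hM
    refine hM (fun M => innerSL ℂ v (P M.adjugate (A (P M v)))) ?_ fun g => ?_
    · exact (innerSL ℂ v).differentiable.comp ((hd.comp hadj).clm_apply
        (A.differentiable.comp (hd.clm_apply (differentiable_const v))))
    · rw [SU3.adjugate_eq_star, ← SU3.coe_inv, hP.apply_coe, hP.apply_coe, innerSL_apply_apply,
        ← inner_map_left]
      exact hA g
  have h2 : ∀ g : SU3, ∀ u, inner ℂ ((ρ g : H →L[ℂ] H) v) (A ((ρ g : H →L[ℂ] H) u)) = 0 := by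
    intro g u
    set B := (ρ g⁻¹ : H →L[ℂ] H) * A * (ρ g : H →L[ℂ] H) with hB
    -- Evaluate `h1` at `gL`: the factor `L⁻¹` disappears into `⟪v, ·⟫`, leaving `⟪v, B P(L) v⟫ = 0`
    -- for every lower unipotent `L`.
    have hB0 : ContinuousLinearMap.adjoint B v = 0 := by
      refine hP.eq_zero_of_inner_lowerUnipotent hρ hμ hv hv0 fun a b c => ?_
      have hL := SU3.lowerUnipotent_mem_hull a b c
      have hg := SU3.coe_mem_hull g
      have hLinv := hadjmem _ hL
      have h3 := h1 _ (SU3.hull.mul_mem hg hL)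
      have h4 : (Matrix.lowerUnipotent a b c).adjugate =
          Matrix.lowerUnipotent (-a) (a * c - b) (-c) := by
        ext i j
        fin_cases i <;> fin_cases j <;> simp [Matrix.lowerUnipotent, Matrix.adjugate_fin_three]
      rw [Matrix.adjugate_mul_distrib, hP.map_mul hLinv (hadjmem _ hg), hP.map_mul hg hL,
        SU3.adjugate_eq_star, ← SU3.coe_inv, hP.apply_coe, hP.apply_coe, h4] at h3
      simp only [mul_apply_eq_comp] at h3
      rw [hP.inner_lowerUnipotent_apply hμ hv] at h3
      rw [ContinuousLinearMap.adjoint_inner_left, hB]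
      exact h3
    rw [inner_map_left]
    change inner ℂ v (B u) = 0
    rw [← ContinuousLinearMap.adjoint_inner_left, hB0, inner_zero_left]
  ext u
  refine eq_zero_of_inner_orbit hρ hv0 fun g => ?_
  have h3 := h2 g ((ρ g⁻¹ : H →L[ℂ] H) u)
  rw [← coe_map_mul_apply, mul_inv_cancel, coe_map_one] at h3
  rw [← inner_conj_symm]
  exact (map_eq_zero _).2 h3

end HighestWeight

/-! ### Averages of conjugates -/

section Kernel

variable {H : Type*} [NormedAddCommGroup H] [InnerProductSpace ℂ H] [CompleteSpace H]
  {ρ : SU3 →* unitary (H →L[ℂ] H)}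

lemma SU3.continuous_conjAction (hρ : Continuous ρ) (K : H →L[ℂ] H) :
    Continuous fun g => conjAction ρ g K := by
  have hR : Continuous fun g : SU3 => (ρ g : H →L[ℂ] H) := continuous_subtype_val.comp hρ
  exact (hR.mul continuous_const).mul (hR.comp continuous_inv)

/-- The map `B ↦ tr (A B)`, as a continuous linear functional. -/
def opTraceMulLeft [FiniteDimensional ℂ H] (A : H →L[ℂ] H) : (H →L[ℂ] H) →L[ℂ] ℂ :=
  LinearMap.toContinuousLinearMap
    { toFun := fun B => opTrace (A * B)
      map_add' := fun B C => by
        simp only [mul_add, opTrace, ContinuousLinearMap.toLinearMap_add, map_add]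
      map_smul' := fun c B => by
        simp only [mul_smul_comm, opTrace, ContinuousLinearMap.toLinearMap_smul, map_smul,
          RingHom.id_apply] }

lemma opTrace_mul_comm (A B : H →L[ℂ] H) : opTrace (A * B) = opTrace (B * A) :=
  LinearMap.trace_mul_comm ℂ (A : H →ₗ[ℂ] H) (B : H →ₗ[ℂ] H)

lemma opTrace_conjAction (g : SU3) (K : H →L[ℂ] H) : opTrace (conjAction ρ g K) = opTrace K := by
  rw [conjAction, opTrace_mul_comm, ← mul_assoc, map_inv_mul_cancel, one_mul]

/-- Schur's lemma. -/
lemma exists_eq_smul_one_of_commute [FiniteDimensional ℂ H]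
    (hirr : (toRepresentation ρ).IsIrreducible) [Nontrivial H] {C : H →L[ℂ] H}
    (hC : ∀ g : SU3, (ρ g : H →L[ℂ] H) * C = C * (ρ g : H →L[ℂ] H)) : ∃ c : ℂ, C = c • 1 := by
  obtain ⟨c, hc⟩ := Module.End.exists_eigenvalue (C : H →ₗ[ℂ] H)
  refine ⟨c, ?_⟩
  have htop := eq_top_of_irreducible hirr (Module.End.eigenspace (C : H →ₗ[ℂ] H) c)
    (fun g u hu => ?_) hc
  · ext u
    have hu : u ∈ Module.End.eigenspace (C : H →ₗ[ℂ] H) c := htop ▸ Submodule.mem_top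
    simpa using Module.End.mem_eigenspace_iff.1 hu
  · rw [Module.End.mem_eigenspace_iff] at hu ⊢
    have h := congrArg (fun B : H →L[ℂ] H => B u) (hC g)
    simp only [mul_apply_eq_comp] at h
    change C u = c • u at hu
    change C _ = _
    rw [← h, hu, map_smul]

/-- The average over `SU(3)` of the conjugates of an operator. -/
lemma integral_opTrace_mul_conjAction [FiniteDimensional ℂ H] (hρ : Continuous ρ)
    (hirr : (toRepresentation ρ).IsIrreducible) [Nontrivial H] (A K : H →L[ℂ] H) :
    ∫ g, opTrace (A * conjAction ρ g K) ∂SU3.haar =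
      (Module.finrank ℂ H : ℂ)⁻¹ * opTrace A * opTrace K := by
  set C : H →L[ℂ] H := ∫ g, conjAction ρ g K ∂SU3.haar with hCdef
  have hint := SU3.integrable_of_continuous (SU3.continuous_conjAction hρ K)
  have hL : ∀ A : H →L[ℂ] H, ∫ g, opTrace (A * conjAction ρ g K) ∂SU3.haar = opTrace (A * C) :=
    fun A => (opTraceMulLeft A).integral_comp_comm hint
  -- By left invariance of Haar measure the average commutes with the representation, so Schur's
  -- lemma makes it a scalar; taking `A = 1` then computes the scalar from the trace of `K`.
  have hcomm : ∀ g : SU3, (ρ g : H →L[ℂ] H) * C = C * (ρ g : H →L[ℂ] H) := by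
    intro g
    have h1 : (ρ g : H →L[ℂ] H) * C = ∫ k, (ρ g : H →L[ℂ] H) * conjAction ρ k K ∂SU3.haar :=
      ((ContinuousLinearMap.mul ℂ (H →L[ℂ] H) (ρ g : H →L[ℂ] H)).integral_comp_comm hint).symm
    have h2 : C * (ρ g : H →L[ℂ] H) = ∫ k, conjAction ρ k K * (ρ g : H →L[ℂ] H) ∂SU3.haar :=
      (((ContinuousLinearMap.mul ℂ (H →L[ℂ] H)).flip
        (ρ g : H →L[ℂ] H)).integral_comp_comm hint).symm
    rw [h1, h2, ← integral_mul_left_eq_self (fun k => conjAction ρ k K * (ρ g : H →L[ℂ] H)) g]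
    congr 1
    funext k
    rw [conjAction, conjAction, mul_inv_rev, coe_map_mul, coe_map_mul]
    simp only [mul_assoc]
    rw [map_inv_mul_cancel, mul_one]
  obtain ⟨c, hc⟩ := exists_eq_smul_one_of_commute hirr hcomm
  have hA : ∀ A : H →L[ℂ] H, opTrace (A * C) = c * opTrace A := by
    intro A
    rw [hc, mul_smul_comm, mul_one, opTrace, ContinuousLinearMap.toLinearMap_smul, map_smul]
    rfl
  have h1 : c * (Module.finrank ℂ H : ℂ) = opTrace K := by
    have h := hL 1
    simp only [one_mul, opTrace_conjAction] at h
    rw [← one_mul C, hA 1] at h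
    simpa [opTrace] using h.symm
  have hn : (Module.finrank ℂ H : ℂ) ≠ 0 := by
    exact_mod_cast Module.finrank_pos.ne'
  rw [hL, hA, ← h1]
  field_simp

/-! ### Kernels given by weight vectors -/

lemma conjAction_starProjection [FiniteDimensional ℂ H] {u : H} (hu : ‖u‖ = 1) (g : SU3) :
    conjAction ρ g (Submodule.span ℂ {u}).starProjection =
      InnerProductSpace.rankOne ℂ ((ρ g : H →L[ℂ] H) u) ((ρ g : H →L[ℂ] H) u) := by
  ext x
  rw [conjAction, mul_apply_eq_comp, mul_apply_eq_comp,
    Submodule.starProjection_unit_singleton ℂ hu, map_smul, InnerProductSpace.rankOne_apply,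
    inner_map_left]

lemma opTrace_mul_conjAction_starProjection [FiniteDimensional ℂ H] {u : H} (hu : ‖u‖ = 1)
    (A : H →L[ℂ] H) (g : SU3) :
    opTrace (A * conjAction ρ g (Submodule.span ℂ {u}).starProjection) =
      inner ℂ ((ρ g : H →L[ℂ] H) u) (A ((ρ g : H →L[ℂ] H) u)) := by
  have h : A * conjAction ρ g (Submodule.span ℂ {u}).starProjection =
      InnerProductSpace.rankOne ℂ (A ((ρ g : H →L[ℂ] H) u)) ((ρ g : H →L[ℂ] H) u) := by
    rw [conjAction_starProjection hu]
    ext x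
    simp
  rw [h]
  exact InnerProductSpace.trace_rankOne _ _

lemma norm_map_apply (ρ : SU3 →* unitary (H →L[ℂ] H)) (g : SU3) (u : H) :
    ‖(ρ g : H →L[ℂ] H) u‖ = ‖u‖ := by
  have h : inner ℂ ((ρ g : H →L[ℂ] H) u) ((ρ g : H →L[ℂ] H) u) = inner ℂ u u := by
    rw [inner_map_left, ← coe_map_mul_apply, inv_mul_cancel, coe_map_one]
    rfl
  rw [norm_eq_sqrt_re_inner (𝕜 := ℂ), norm_eq_sqrt_re_inner (𝕜 := ℂ) u, h]

/-- The symbol `g T ↦ ⟪ρ(g) u, A ρ(g) u⟫`. -/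
def coherentSymbol (ρ : SU3 →* unitary (H →L[ℂ] H)) (u : H) :
    (H →L[ℂ] H) →ₗ[ℂ] (FlagManifold → ℂ) where
  toFun A z := inner ℂ ((ρ z.out : H →L[ℂ] H) u) (A ((ρ z.out : H →L[ℂ] H) u))
  map_add' A B := by
    funext z
    simp
  map_smul' c A := by
    funext z
    simp

/-- The chosen representative of the coset is irrelevant: changing it multiplies `ρ(g) u` by a
phase, which cancels between the two slots. -/
lemma coherentSymbol_mk {u : H}
    (hu : ∀ t ∈ SU3.torus, ∃ c : ℂ, (starRingEnd ℂ) c * c = 1 ∧ (ρ t : H →L[ℂ] H) u = c • u)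
    (A : H →L[ℂ] H) (g : SU3) :
    coherentSymbol ρ u A (g : FlagManifold) =
      inner ℂ ((ρ g : H →L[ℂ] H) u) (A ((ρ g : H →L[ℂ] H) u)) := by
  obtain ⟨⟨t, ht⟩, h⟩ := QuotientGroup.mk_out_eq_mul SU3.torus g
  obtain ⟨c, hc, htu⟩ := hu t ht
  change inner ℂ ((ρ (Quotient.out (g : FlagManifold)) : H →L[ℂ] H) u)
    (A ((ρ (Quotient.out (g : FlagManifold)) : H →L[ℂ] H) u)) = _
  rw [show Quotient.out (g : FlagManifold) = g * t from h, coe_map_mul_apply, htu, map_smul,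
    map_smul, inner_smul_left, inner_smul_right, ← mul_assoc, hc, one_mul]

section Smooth

attribute [local instance] Matrix.normedAddCommGroup Matrix.normedSpace

/-- The holomorphic extension serves as a global one. Scalars are restricted to `ℝ` because the
inner product is conjugate-linear in its first slot. -/
lemma SU3.isSmooth_inner [FiniteDimensional ℂ H] (hρ : Continuous ρ) (u : H) (A : H →L[ℂ] H) :
    SU3.IsSmooth fun g => inner ℂ ((ρ g : H →L[ℂ] H) u) (A ((ρ g : H →L[ℂ] H) u)) := by
  obtain ⟨P, hP, hPρ⟩ := exists_contDiff_extension hρ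
  have h1 : ContDiff ℝ ∞ fun M => P M u :=
    (hP.clm_apply (contDiff_const (c := u))).restrict_scalars ℝ
  have h2 : ContDiff ℝ ∞ fun M => A (P M u) :=
    (A.contDiff.comp (hP.clm_apply (contDiff_const (c := u)))).restrict_scalars ℝ
  refine fun g => ⟨Set.univ, isOpen_univ, Set.mem_univ _,
    fun M => inner ℂ (P (Matrix.of M) u) (A (P (Matrix.of M) u)),
    (ContDiff.inner ℂ h1 h2).contDiffOn, fun h _ => ?_⟩
  have : Matrix.of h.entries = h.1 := rfl
  simp only [this, hPρ]

end Smooth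

/-- The projector onto a one-dimensional weight space is an operator kernel as soon as the
diagonal matrix elements in its orbit determine an operator. -/
lemma isOperatorKernel_weightProjector [FiniteDimensional ℂ H] (hρ : Continuous ρ)
    (hirr : (toRepresentation ρ).IsIrreducible) {z₀ : FlagManifold}
    (hz₀ : MulAction.stabilizer SU3 z₀ = SU3.torus) {μ : Weight} {u : H}
    (hu : ‖u‖ = 1) (hμ : weightSpace ρ μ = Submodule.span ℂ {u})
    (hinj : ∀ A : H →L[ℂ] H,
      (∀ g : SU3, inner ℂ ((ρ g : H →L[ℂ] H) u) (A ((ρ g : H →L[ℂ] H) u)) = 0) → A = 0) :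
    IsOperatorKernel ρ z₀ (weightProjector ρ μ) := by
  have huμ : u ∈ weightSpace ρ μ := hμ ▸ Submodule.mem_span_singleton_self u
  have : Nontrivial H := ⟨u, 0, fun h => by simp [h] at hu⟩
  obtain ⟨g₀, rfl⟩ := QuotientGroup.mk_surjective z₀
  -- The symbol is built from the base coset `T`, whereas the kernel refers to `z₀ = g₀ T`; this
  -- twist makes the value at `g z₀` involve `ρ(g) u`.
  set u' := (ρ g₀⁻¹ : H →L[ℂ] H) u with hu'
  have hu'1 : ‖u'‖ = 1 := by rw [hu', norm_map_apply, hu]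
  have hphase : ∀ t ∈ SU3.torus,
      ∃ c : ℂ, (starRingEnd ℂ) c * c = 1 ∧ (ρ t : H →L[ℂ] H) u' = c • u' := by
    intro t ht
    -- The isotropy group of `z₀` is `g₀ T g₀⁻¹`, so the hypothesis says that `g₀` normalizes `T`;
    -- hence `u'` is still a torus eigenvector.
    have ht' : g₀ * t * g₀⁻¹ ∈ SU3.torus := by
      rw [← hz₀, MulAction.mem_stabilizer_iff]
      change ((g₀ * t * g₀⁻¹ * g₀ : SU3) : FlagManifold) = (g₀ : FlagManifold)
      rw [inv_mul_cancel_right]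
      exact QuotientGroup.mk_mul_of_mem g₀ ht
    refine ⟨μ.char (g₀ * t * g₀⁻¹), ?_, ?_⟩
    · rw [Weight.conj_char ht', Weight.char_neg ht', inv_mul_cancel₀ (Weight.char_ne_zero ht' μ)]
    · rw [hu', ← map_smul, ← huμ _ ht', ← coe_map_mul_apply, ← coe_map_mul_apply]
      congr 3
      group
  have hmk := fun A g => coherentSymbol_mk hphase A g
  have hmk₀ : ∀ A (g : SU3), coherentSymbol ρ u' A (g • (g₀ : FlagManifold)) =
      inner ℂ ((ρ g : H →L[ℂ] H) u) (A ((ρ g : H →L[ℂ] H) u)) := by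
    intro A g
    have := hmk A (g * g₀)
    rw [coe_map_mul_apply, hu', ← coe_map_mul_apply ρ g₀, mul_inv_cancel, coe_map_one] at this
    exact this
  refine ⟨coherentSymbol ρ u', ⟨fun A => ?_, ?_, ?_, ?_, fun A => ?_⟩, fun A g => ?_⟩
  · have h : (fun g : SU3 => coherentSymbol ρ u' A (g : FlagManifold)) = _ := funext (hmk A)
    rw [FlagManifold.IsSmooth, h]
    exact SU3.isSmooth_inner hρ u' A
  · refine (injective_iff_map_eq_zero _).2 fun A hA => hinj A fun g => ?_
    rw [← hmk₀, hA]
    rfl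
  · intro g A z
    obtain ⟨k, rfl⟩ := QuotientGroup.mk_surjective z
    change _ = coherentSymbol ρ u' A ((g⁻¹ * k : SU3) : FlagManifold)
    rw [hmk, hmk, conjAction, mul_apply_eq_comp, mul_apply_eq_comp, coe_map_mul_apply,
      inner_map_left ρ g⁻¹, inv_inv]
  · intro A z
    obtain ⟨k, rfl⟩ := QuotientGroup.mk_surjective z
    rw [hmk, hmk, ContinuousLinearMap.adjoint_inner_right, inner_conj_symm]
  · have hR : Continuous fun g : SU3 => (ρ g : H →L[ℂ] H) := continuous_subtype_val.comp hρ
    have hcont : Continuous fun g : SU3 => coherentSymbol ρ u' A (g : FlagManifold) := by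
      simp only [hmk]
      fun_prop
    have hmeas : Measurable (coherentSymbol ρ u' A) := measurable_from_quotient.2 hcont.measurable
    have hmkm : Measurable (QuotientGroup.mk : SU3 → FlagManifold) :=
      measurable_quotient_mk''
    rw [FlagManifold.measure, integral_map hmkm.aemeasurable hmeas.aestronglyMeasurable]
    simp only [hmk, ← opTrace_mul_conjAction_starProjection hu'1]
    rw [integral_opTrace_mul_conjAction hρ hirr]
    have h1 := opTrace_mul_conjAction_starProjection (ρ := ρ) hu'1 1 1
    rw [one_mul, opTrace_conjAction, coe_map_one] at h1
    rw [h1]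
    simp [inner_self_eq_norm_sq_to_K, hu'1]
  · rw [hmk₀, weightProjector]
    simp only [hμ]
    rw [opTrace_mul_conjAction_starProjection hu]

/-! ### The longest Weyl group element and the lowest weight -/

/-- A representative of the longest element of the Weyl group. -/
def SU3.longest : SU3 := ⟨!![0, 0, 1; 0, -1, 0; 1, 0, 0], by
  refine Matrix.mem_specialUnitaryGroup_iff.2 ⟨Matrix.mem_unitaryGroup_iff.2 ?_, ?_⟩
  · ext i j
    fin_cases i <;> fin_cases j <;> simp [Matrix.mul_apply, Fin.sum_univ_three, Matrix.star_apply]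
  · simp [Matrix.det_fin_three]⟩

lemma SU3.longest_conj_apply {t : SU3} (ht : t ∈ SU3.torus) :
    (SU3.longest⁻¹ * t * SU3.longest).1 =
      !![t.1 2 2, 0, 0; 0, t.1 1 1, 0; 0, 0, t.1 0 0] := by
  change star SU3.longest.1 * t.1 * SU3.longest.1 = _
  have h : ∀ i j : Fin 3, i ≠ j → t.1 i j = 0 := fun i j => SU3.torus_apply_of_ne ht
  ext i j
  fin_cases i <;> fin_cases j <;>
    simp [SU3.longest, Matrix.mul_apply, Fin.sum_univ_three, Matrix.star_apply, h]

lemma SU3.longest_conj_mem_torus {t : SU3} (ht : t ∈ SU3.torus) :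
    SU3.longest⁻¹ * t * SU3.longest ∈ SU3.torus := by
  change (SU3.longest⁻¹ * t * SU3.longest).1.IsDiag
  rw [SU3.longest_conj_apply ht]
  intro i j hij
  fin_cases i <;> fin_cases j <;> simp at hij ⊢

/-- The longest element exchanges `t₀` and `t₂`, and `t₂` is eliminated by the determinant relation.
-/
lemma Weight.char_longest_conj {t : SU3} (ht : t ∈ SU3.torus) (μ : Weight) :
    μ.char (SU3.longest⁻¹ * t * SU3.longest) = Weight.char (-μ.2, -μ.1) t := by
  have h0 := SU3.torus_apply_ne_zero ht 0
  have h1 := SU3.torus_apply_ne_zero ht 1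
  have h2 : t.1 2 2 = (t.1 0 0)⁻¹ * (t.1 1 1)⁻¹ := by
    rw [← mul_inv]
    exact eq_inv_of_mul_eq_one_right (SU3.torus_prod ht)
  simp only [Weight.char, SU3.longest_conj_apply ht]
  simp only [Matrix.of_apply, Matrix.cons_val', Matrix.cons_val_zero, Matrix.cons_val_one]
  rw [h2, mul_zpow, inv_zpow', inv_zpow', mul_assoc, ← zpow_add₀ h1]
  congr 2 <;> ring

lemma map_longest_mem_weightSpace {μ : Weight} {v : H} (hv : v ∈ weightSpace ρ μ) :
    (ρ SU3.longest : H →L[ℂ] H) v ∈ weightSpace ρ (-μ.2, -μ.1) := by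
  intro t ht
  have h := hv _ (SU3.longest_conj_mem_torus ht)
  rw [Weight.char_longest_conj ht] at h
  rw [← map_smul, ← h, ← coe_map_mul_apply, ← coe_map_mul_apply]
  congr 3
  group

lemma map_longest_inv_mem_weightSpace {μ : Weight} {v : H} (hv : v ∈ weightSpace ρ μ) :
    (ρ SU3.longest⁻¹ : H →L[ℂ] H) v ∈ weightSpace ρ (-μ.2, -μ.1) := by
  have h : SU3.longest⁻¹ = SU3.longest := by
    refine Subtype.ext ?_
    change star SU3.longest.1 = SU3.longest.1
    ext i j
    fin_cases i <;> fin_cases j <;> simp [SU3.longest, Matrix.star_apply]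
  rw [h]
  exact map_longest_mem_weightSpace hv

lemma weightSpace_longest_eq_span {μ : Weight} {v : H}
    (hμ : weightSpace ρ μ = Submodule.span ℂ {v}) :
    weightSpace ρ (-μ.2, -μ.1) = Submodule.span ℂ {(ρ SU3.longest : H →L[ℂ] H) v} := by
  have hv : v ∈ weightSpace ρ μ := hμ ▸ Submodule.mem_span_singleton_self v
  refine le_antisymm (fun u hu => ?_) ((Submodule.span_singleton_le_iff_mem _ _).2
    (map_longest_mem_weightSpace hv))
  have h := map_longest_inv_mem_weightSpace hu
  simp only [neg_neg] at h
  rw [Prod.mk.eta, hμ] at h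
  obtain ⟨c, hcu⟩ := Submodule.mem_span_singleton.1 h
  refine Submodule.mem_span_singleton.2 ⟨c, ?_⟩
  rw [← map_smul, hcu, ← coe_map_mul_apply, mul_inv_cancel, coe_map_one]
  rfl

lemma IsWeight.map_longest {μ : Weight} (hμ : IsWeight ρ μ) : IsWeight ρ (-μ.2, -μ.1) := by
  obtain ⟨v, hv, hv0⟩ := Submodule.exists_mem_ne_zero_of_ne_bot hμ
  refine (Submodule.ne_bot_iff _).2 ⟨_, map_longest_mem_weightSpace hv, fun h => hv0 ?_⟩
  rw [← norm_eq_zero, ← norm_map_apply ρ SU3.longest, h, norm_zero]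

lemma IsHighestWeight.isLowestWeight {μ : Weight} (hμ : IsHighestWeight ρ μ) :
    IsLowestWeight ρ (-μ.2, -μ.1) := by
  refine ⟨hμ.1.map_longest, fun τ hτ => ?_⟩
  obtain ⟨c₁, c₂, hc⟩ := hμ.2 _ hτ.map_longest
  have h1 := congrArg Prod.fst hc
  have h2 := congrArg Prod.snd hc
  -- The coefficients swap because the longest element sends `α₁` to `-α₂` and `α₂` to `-α₁`.
  refine ⟨c₂, c₁, Prod.ext ?_ ?_⟩ <;> simp [simpleRoot₁, simpleRoot₂] at h1 h2 ⊢ <;> omega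

end Kernel

end

theorem theorem4p16 {H : Type*} [NormedAddCommGroup H] [InnerProductSpace ℂ H] [CompleteSpace H]
    [FiniteDimensional ℂ H] (p q : ℕ) (ρ : SU3 →* unitary (H →L[ℂ] H))
    (hρ : IsIrrepOfClass ρ p q)
    (z₀ : FlagManifold) (hz₀ : MulAction.stabilizer SU3 z₀ = SU3.torus) :
    IsOperatorKernel ρ z₀ (weightProjector ρ ((p : ℤ), (q : ℤ))) ∧
    IsLowestWeight ρ (-(q : ℤ), -(p : ℤ)) ∧
    IsOperatorKernel ρ z₀ (weightProjector ρ (-(q : ℤ), -(p : ℤ))) := by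
  obtain ⟨hc, hirr, hμ⟩ := hρ
  obtain ⟨P, hP₁, hP₂⟩ := exists_contDiff_extension hc
  have hP : IsExtension ρ P := ⟨hP₁, hP₂⟩
  obtain ⟨w, hw, hw0⟩ := Submodule.exists_mem_ne_zero_of_ne_bot hμ.1
  obtain ⟨v, hv, hv1⟩ : ∃ v ∈ weightSpace ρ ((p : ℤ), (q : ℤ)), ‖v‖ = 1 :=
    ⟨(‖w‖⁻¹ : ℂ) • w, Submodule.smul_mem _ _ hw, by
      simp [norm_smul, norm_ne_zero_iff.2 hw0]⟩
  have hv0 : v ≠ 0 := fun h => by simp [h] at hv1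
  have hspan := hP.weightSpace_eq_span hirr hμ hv hv0
  have hinj : ∀ A : H →L[ℂ] H,
      (∀ g : SU3, inner ℂ ((ρ g : H →L[ℂ] H) v) (A ((ρ g : H →L[ℂ] H) v)) = 0) → A = 0 :=
    fun A hA => hP.eq_zero_of_inner_coherent hirr hμ hv hv0 hA
  have hspan' := weightSpace_longest_eq_span hspan
  have hv1' : ‖(ρ SU3.longest : H →L[ℂ] H) v‖ = 1 := by rw [norm_map_apply, hv1]
  refine ⟨isOperatorKernel_weightProjector hc hirr hz₀ hv1 hspan hinj, hμ.isLowestWeight,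
    isOperatorKernel_weightProjector hc hirr hz₀ hv1' hspan' fun A hA => hinj A fun g => ?_⟩
  -- The lowest weight vector is a translate of `v`, so the two orbits coincide and injectivity
  -- carries over.
  have h := hA (g * SU3.longest⁻¹)
  rwa [← coe_map_mul_apply, inv_mul_cancel_right] at h
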